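/- A (pointed) metric measure space $(X,r,\rho,\mu)$ consists of a complete separable metric space $(X,r)$, a point $\rho\in X$ and a Borel measure $\mu$ on $X$; it is boundedly finite if $\mu$ is finite on all bounded subsets of $X$. Two such spaces $(X,r,\rho,\mu)$, $(X',r',\rho',\mu')$ are equivalent if there is an isometry $\phi$ from $\operatorname{supp}(\mu)\cup\{\rho\}$ onto $\operatorname{supp}(\mu')\cup\{\rho'\}$ with $\phi(\rho)=\rho'$ and $\phi_*\mu=\mu'$. Let $\mathbb{X}$ be the set of equivalence classes of boundedly finite metric measure spaces, let $\mathbb{X}_{\mathrm{HB}}\subseteq\mathbb{X}$ be the set of classes containing a representative with $(X,r)$ Heine–Borel (every bounded closed subset is compact), and let $\mathbb{X}_{\mathrm{c}}\subseteq\mathbb{X}_{\mathrm{HB}}$ be the set of classes containing a representative with $(X,r)$ compact. For a metric measure space with finite measure and $m\in\mathbb{N}$, its $m$-point distance matrix distribution is the image of $\mu^{\otimes m}$ under $(x_1,\dots,x_m)\mapsto (r(x_i,x_j))_{0\le i<j\le m}$, where $x_0:=\rho$; a sequence of such spaces converges Gromov-weakly if for every $m$ the $m$-point distance matrix distributions converge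 weakly to that of the limit. A sequence $(X_n,r_n,\rho_n,\mu_n)$ of boundedly finite metric measure spaces converges Gromov-vaguely to $(X,r,\rho,\mu)$ if for every $R>0$ with $\mu(\{x\in X: r(\rho,x)=R\})=0$, the spaces $(X_n,r_n,\rho_n,\mu_n|_{\overline B(\rho_n,R)})$ converge Gromov-weakly to $(X,r,\rho,\mu|_{\overline B(\rho,R)})$. The Gromov-vague topology on $\mathbb{X}$ is the topology determined by this convergence of sequences: a set $U\subseteq\mathbb{X}$ is open if and only if every sequence converging Gromov-vaguely to an element of $U$ is eventually in $U$. A topological space is called a Lusin space if it is metrizable and is the image of a Polish space under a continuous bijective map. **Corollary ($\mathbb{X}_{\mathrm{HB}}$ and $\mathbb{X}_{\mathrm{c}}$ are Lusin).** With the subspace topology of the Gromov-vague topology, $\mathbb{X}_{\mathrm{HB}}$ is a Lusin space but not a Polish space, and $\mathbb{X}_{\mathrm{c}}$ is a Lusin space but not a Polish space. -/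

import Mathlib

open MeasureTheory Filter Topology
open scoped NNReal

/-- A pointed, complete, separable metric space with a boundedly finite Borel measure
(not yet up to equivalence). Every separable metric space has at most the cardinality of the
continuum, so carriers in `Type` represent all of them. -/
structure PointedMMSpace where
  carrier : Type
  [metricSpace : MetricSpace carrier]
  [completeSpace : CompleteSpace carrier]
  [separableSpace : TopologicalSpace.SeparableSpace carrier]
  [measurableSpace : MeasurableSpace carrier]
  [borelSpace : BorelSpace carrier]
  root : carrier
  measure : Measure carrier
  boundedlyFinite : ∀ s : Set carrier, Bornology.IsBounded s → measure s < ⊤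

namespace PointedMMSpace

attribute [instance] metricSpace completeSpace separableSpace measurableSpace borelSpace

/-- The set `supp(μ) ∪ {ρ}`. -/
def core (X : PointedMMSpace) : Set X.carrier := X.measure.support ∪ {X.root}

theorem root_mem_core (X : PointedMMSpace) : X.root ∈ X.core := Or.inr rfl

/-- The measure `μ`, viewed as a measure on the subspace `supp(μ) ∪ {ρ}` (which is closed and whose
complement is `μ`-null). -/
noncomputable def coreMeasure (X : PointedMMSpace) : Measure X.core :=
  X.measure.comap Subtype.val

/-- Equivalence: a root preserving and measure preserving isometry between
`supp(μ) ∪ {ρ}` and `supp(μ') ∪ {ρ'}`. -/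
def Equivalent (X Y : PointedMMSpace) : Prop :=
  ∃ φ : X.core ≃ᵢ Y.core,
    φ ⟨X.root, X.root_mem_core⟩ = ⟨Y.root, Y.root_mem_core⟩ ∧
      X.coreMeasure.map φ = Y.coreMeasure

theorem equivalent_equivalence : Equivalence Equivalent where
  refl X := ⟨IsometryEquiv.refl _, rfl, Measure.map_id⟩
  symm := by
    rintro X Y ⟨φ, h, hm⟩
    refine ⟨φ.symm, by rw [← h, φ.symm_apply_apply], ?_⟩
    rw [← hm, Measure.map_map φ.symm.continuous.measurable φ.continuous.measurable]
    have : (φ.symm ∘ φ : X.core → X.core) = id := by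
      ext x
      simp
    rw [this, Measure.map_id]
  trans := by
    rintro X Y Z ⟨φ, h, hm⟩ ⟨ψ, h', hm'⟩
    refine ⟨φ.trans ψ, by rw [IsometryEquiv.trans_apply, h, h'], ?_⟩
    rw [← hm', ← hm, Measure.map_map ψ.continuous.measurable φ.continuous.measurable]
    rfl

instance setoid : Setoid PointedMMSpace := ⟨Equivalent, equivalent_equivalence⟩

/-- The restriction `(X, r, ρ, μ|_{B̄(ρ, R)})` to the closed ball of radius `R` around the root. -/
noncomputable def restrictBall (X : PointedMMSpace) (R : ℝ) : PointedMMSpace where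
  carrier := X.carrier
  root := X.root
  measure := X.measure.restrict (Metric.closedBall X.root R)
  boundedlyFinite s hs := (Measure.restrict_apply_le _ s).trans_lt (X.boundedlyFinite s hs)

instance isFiniteMeasure_restrictBall (X : PointedMMSpace) (R : ℝ) :
    IsFiniteMeasure (X.restrictBall R).measure :=
  ⟨by
    change X.measure.restrict (Metric.closedBall X.root R) Set.univ < ⊤
    rw [Measure.restrict_apply_univ]
    exact X.boundedlyFinite _ Metric.isBounded_closedBall⟩

/-- The index set of the pairs `0 ≤ i < j ≤ m`. -/
abbrev PairIndex (m : ℕ) : Type := {p : Fin (m + 1) × Fin (m + 1) // p.1 < p.2}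

/-- The distances `r(x_i, x_j)`, `0 ≤ i < j ≤ m`, where `x_0 = ρ`. -/
noncomputable def distMatrix (X : PointedMMSpace) (m : ℕ) (x : Fin m → X.carrier) :
    PairIndex m → ℝ≥0 :=
  fun p => nndist ((Fin.cons X.root x : Fin (m + 1) → X.carrier) p.1.1)
    ((Fin.cons X.root x : Fin (m + 1) → X.carrier) p.1.2)

/-- The `m`-point distance matrix distribution of a space with finite measure: the image of the
product measure `μ^{⊗m}` under the distance matrix map. -/
noncomputable def distMatrixDistribution (X : PointedMMSpace) [IsFiniteMeasure X.measure] (m : ℕ) :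
    FiniteMeasure (PairIndex m → ℝ≥0) :=
  ⟨(Measure.pi fun _ : Fin m => X.measure).map (X.distMatrix m), inferInstance⟩

/-- Gromov-weak convergence of spaces with finite measures: weak convergence of all distance
matrix distributions. -/
def GromovWeakTendsto (Xs : ℕ → PointedMMSpace) (X : PointedMMSpace)
    [∀ n, IsFiniteMeasure (Xs n).measure] [IsFiniteMeasure X.measure] : Prop :=
  ∀ m : ℕ, Tendsto (fun n => (Xs n).distMatrixDistribution m) atTop
    (𝓝 (X.distMatrixDistribution m))

/-- Gromov-vague convergence: the restrictions to the closed balls of radius `R` around the roots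
converge Gromov-weakly, for all `R > 0` such that the sphere of radius `R` around the root of the
limit is a null set. -/
def GromovVagueTendsto (Xs : ℕ → PointedMMSpace) (X : PointedMMSpace) : Prop :=
  ∀ R : ℝ, 0 < R → X.measure (Metric.sphere X.root R) = 0 →
    GromovWeakTendsto (fun n => (Xs n).restrictBall R) (X.restrictBall R)

end PointedMMSpace

/-- The space `𝕏` of equivalence classes of metric boundedly finite measure spaces. -/
def MMSpace : Type 1 := Quotient PointedMMSpace.setoid

namespace MMSpace

/-- The equivalence class of a metric boundedly finite measure space. -/
def mk (X : PointedMMSpace) : MMSpace := Quotient.mk PointedMMSpace.setoid X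

/-- The Gromov-vague topology, as the topology determined by Gromov-vague convergence of sequences:
a set is open iff every sequence that converges Gromov-vaguely to one of its points is
eventually in the set. -/
instance gromovVagueTopology : TopologicalSpace MMSpace where
  IsOpen U := ∀ (Xs : ℕ → PointedMMSpace) (X : PointedMMSpace),
    PointedMMSpace.GromovVagueTendsto Xs X → mk X ∈ U → ∀ᶠ n in atTop, mk (Xs n) ∈ U
  isOpen_univ _ _ _ _ := Eventually.of_forall fun _ => Set.mem_univ _
  isOpen_inter _ _ hU hV Xs X h hX := (hU Xs X h hX.1).and (hV Xs X h hX.2)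
  isOpen_sUnion S hS Xs X h := by
    rintro ⟨U, hU, hX⟩
    exact (hS U hU Xs X h hX).mono fun n hn => ⟨U, hU, hn⟩

/-- `𝕏_HB`: the classes containing a representative whose metric space is Heine-Borel, i.e. all of
whose bounded closed subsets are compact. -/
def heineBorel : Set MMSpace :=
  {x | ∃ X : PointedMMSpace, mk X = x ∧ ProperSpace X.carrier}

/-- `𝕏_c`: the classes in `𝕏_HB` containing a representative whose metric space is compact. -/
def compact : Set MMSpace :=
  {x | x ∈ heineBorel ∧ ∃ X : PointedMMSpace, mk X = x ∧ CompactSpace X.carrier}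

end MMSpace

/-- A Lusin space: a metrizable topological space that is the image of a Polish space under a
continuous bijective map. -/
def IsLusinSpace.{u} (X : Type u) [TopologicalSpace X] : Prop :=
  TopologicalSpace.MetrizableSpace X ∧
    ∃ (P : Type u) (_ : TopologicalSpace P) (f : P → X),
      PolishSpace P ∧ Continuous f ∧ Function.Bijective f

/-! ### Products and restrictions of weakly convergent finite measures. -/

section General

open scoped ENNReal BoundedContinuousFunction

/-- Tonelli's theorem for a product of functions of the single coordinates. -/
theorem lintegral_fin_prod_eq_prod {α : Type*} [MeasurableSpace α] {n : ℕ}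
    (μ : Fin n → Measure α) [∀ i, SigmaFinite (μ i)] {f : Fin n → α → ℝ≥0∞}
    (hf : ∀ i, Measurable (f i)) :
    ∫⁻ x, ∏ i, f i (x i) ∂(Measure.pi μ) = ∏ i, ∫⁻ x, f i x ∂(μ i) := by
  induction n with
  | zero => simp
  | succ n ih =>
    have h := (measurePreserving_piFinSuccAbove μ 0).symm
    have hm : Measurable fun x : Fin (n + 1) → α => ∏ i, f i (x i) := by fun_prop
    rw [← h.lintegral_comp hm]
    simp_rw [MeasurableEquiv.piFinSuccAbove_symm_apply, Fin.insertNthEquiv, Fin.prod_univ_succ,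
      Equiv.coe_fn_mk, Fin.insertNth_zero, Fin.cons_succ, Fin.cons_zero]
    have hg : Measurable fun x : Fin n → α => ∏ i, f i.succ (x i) := by fun_prop
    have := lintegral_prod_mul (μ := μ 0) (ν := Measure.pi fun i : Fin n => μ i.succ)
      (hf 0).aemeasurable hg.aemeasurable
    rw [← ih (fun i => μ i.succ) (fun i => hf i.succ)]
    exact this

/-- The product of measures with densities. -/
theorem pi_withDensity {α : Type*} [MeasurableSpace α] (n : ℕ) (μ : Measure α) [SigmaFinite μ]
    {g : α → ℝ≥0} (hg : Measurable g) :
    Measure.pi (fun _ : Fin n => μ.withDensity fun x => (g x : ℝ≥0∞)) =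
      (Measure.pi fun _ : Fin n => μ).withDensity fun x => ((∏ i, g (x i) : ℝ≥0) : ℝ≥0∞) := by
  refine Measure.pi_eq fun s hs => ?_
  rw [withDensity_apply _ (MeasurableSet.univ_pi hs), Measure.restrict_pi_pi]
  simp_rw [ENNReal.ofNNReal_finsetProd]
  rw [lintegral_fin_prod_eq_prod (fun i => μ.restrict (s i)) (f := fun _ x => (g x : ℝ≥0∞))
    (fun _ => by fun_prop)]
  exact Finset.prod_congr rfl fun i _ => (withDensity_apply _ (hs i)).symm

/-- Splitting off the mass reduces continuity of powers to the case of probability measures. -/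
theorem FiniteMeasure.pi_eq_smul {α : Type*} [MeasurableSpace α] [Nonempty α] (n : ℕ)
    (μ : FiniteMeasure α) :
    FiniteMeasure.pi (fun _ : Fin n => μ) =
      μ.mass ^ n • (ProbabilityMeasure.pi fun _ : Fin n => μ.normalize).toFiniteMeasure := by
  apply Subtype.ext
  refine Measure.pi_eq fun s _ => ?_
  change (μ.mass ^ n • Measure.pi fun _ : Fin n => (μ.normalize : Measure α)) _ = _
  rw [Measure.smul_apply, Measure.pi_pi]
  have : ∀ t : Set α, (μ : Measure α) t = μ.mass * (μ.normalize : Measure α) t := fun t => by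
    rw [← FiniteMeasure.ennreal_coeFn_eq_coeFn_toMeasure, μ.self_eq_mass_mul_normalize t,
      ENNReal.coe_mul, ProbabilityMeasure.ennreal_coeFn_eq_coeFn_toMeasure]
  rw [Finset.prod_congr rfl fun i _ => this (s i), Finset.prod_mul_distrib]
  simp [ENNReal.smul_def]

/-- Weak convergence of finite measures implies weak convergence of their powers. -/
theorem FiniteMeasure.tendsto_pi {α ι : Type*} [MeasurableSpace α] [TopologicalSpace α]
    [SecondCountableTopology α] [TopologicalSpace.PseudoMetrizableSpace α]
    [OpensMeasurableSpace α] {l : Filter ι} (n : ℕ) {κ : ι → FiniteMeasure α} {μ : FiniteMeasure α}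
    (h : Tendsto κ l (𝓝 μ)) :
    Tendsto (fun a => FiniteMeasure.pi fun _ : Fin n => κ a) l
      (𝓝 (FiniteMeasure.pi fun _ : Fin n => μ)) := by
  rcases isEmpty_or_nonempty α with hα | hα
  · have : ∀ a, κ a = μ := fun a => Subtype.ext (by
      ext s; rw [Set.eq_empty_of_isEmpty s, measure_empty, measure_empty])
    simp_rw [this]; exact tendsto_const_nhds
  -- Normalisation is not continuous at the zero measure, so a zero limit is treated through the
  -- masses alone; for `n = 0` the product does not depend on the measure.
  rcases eq_or_ne μ 0 with rfl | h0
  · rcases Nat.eq_zero_or_pos n with rfl | hn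
    · have : ∀ a, FiniteMeasure.pi (fun _ : Fin 0 => κ a) =
          FiniteMeasure.pi fun _ : Fin 0 => (0 : FiniteMeasure α) := fun a => Subtype.ext
        ((Measure.pi_of_empty _ finZeroElim).trans (Measure.pi_of_empty _ finZeroElim).symm)
      simp_rw [this]; exact tendsto_const_nhds
    · have : FiniteMeasure.pi (fun _ : Fin n => (0 : FiniteMeasure α)) = 0 := by
        rw [← FiniteMeasure.mass_zero_iff, FiniteMeasure.mass_pi]
        simp [hn.ne']
      rw [this]
      apply FiniteMeasure.tendsto_zero_of_tendsto_zero_mass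
      simp_rw [FiniteMeasure.mass_pi, Finset.prod_const]
      simpa [hn.ne'] using h.mass.pow n
  · simp_rw [FiniteMeasure.pi_eq_smul]
    have hp : Tendsto (fun a => ProbabilityMeasure.pi fun _ : Fin n => (κ a).normalize) l
        (𝓝 (ProbabilityMeasure.pi fun _ : Fin n => μ.normalize)) :=
      (ProbabilityMeasure.continuous_pi.tendsto (fun _ : Fin n => μ.normalize)).comp
        (tendsto_pi_nhds.2 fun _ => FiniteMeasure.tendsto_normalize_of_tendsto h h0)
    exact (h.mass.pow n).smul
      ((ProbabilityMeasure.tendsto_nhds_iff_toFiniteMeasure_tendsto_nhds l).1 hp)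

/-- If finite measures converge weakly, then so do their restrictions to a closed set whose
frontier is a null set of the limit. -/
theorem FiniteMeasure.tendsto_restrict {α ι : Type*} [MeasurableSpace α]
    [PseudoEMetricSpace α] [OpensMeasurableSpace α] {l : Filter ι}
    {κ : ι → FiniteMeasure α} {μ : FiniteMeasure α} (h : Tendsto κ l (𝓝 μ)) {A : Set α}
    (hA : IsClosed A) (hfr : (μ : Measure α) (frontier A) = 0) :
    Tendsto (fun a => (κ a).restrict A) l (𝓝 (μ.restrict A)) := by
  have hmass : Tendsto (fun a => κ a A) l (𝓝 (μ A)) := by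
    rcases isEmpty_or_nonempty α with hα | hα
    · have h0 : ∀ ν : FiniteMeasure α, ν A = 0 := fun ν => by
        simp [Set.eq_empty_of_isEmpty A, FiniteMeasure.null_iff_toMeasure_null]
      simp_rw [h0]
      exact tendsto_const_nhds
    rcases eq_or_ne μ 0 with rfl | h0
    · refine tendsto_of_tendsto_of_tendsto_of_le_of_le tendsto_const_nhds
        (by simpa using h.mass) (fun _ => zero_le) fun a => (κ a).apply_le_mass A
    · simp_rw [fun a => (κ a).self_eq_mass_mul_normalize A, μ.self_eq_mass_mul_normalize A]
      refine h.mass.mul (ProbabilityMeasure.tendsto_measure_of_null_frontier_of_tendsto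
        (FiniteMeasure.tendsto_normalize_of_tendsto h h0) ?_)
      rw [FiniteMeasure.normalize_eq_of_nonzero _ h0, FiniteMeasure.null_iff_toMeasure_null _ _ |>.2 hfr,
        mul_zero]
  rw [FiniteMeasure.tendsto_iff_forall_integral_tendsto] at h ⊢
  intro g
  have hmass' : Tendsto (fun a => (κ a : Measure α).real A) l (𝓝 ((μ : Measure α).real A)) :=
    (NNReal.continuous_coe.tendsto _).comp hmass
  -- Continuous functions approximating the indicator of `A` from above. Replacing the indicator by
  -- `φ j` costs at most `‖g‖` times the excess mass, and that excess passes to the limit because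
  -- the masses of `A` converge.
  let φ : ℕ → α →ᵇ ℝ := fun j =>
    ⟨⟨fun x => (hA.apprSeq j x : ℝ), by fun_prop⟩, (hA.apprSeq j).map_bounded'⟩
  have hφ0 : ∀ j x, 0 ≤ φ j x := fun j x => NNReal.coe_nonneg _
  have hφ1 : ∀ j x, φ j x ≤ 1 := fun j x => NNReal.coe_le_one.2 (HasOuterApproxClosed.apprSeq_apply_le_one hA j x)
  have hφA : ∀ j, ∀ x ∈ A, φ j x = 1 := fun j x hx =>
    NNReal.coe_eq_one.2 (HasOuterApproxClosed.apprSeq_apply_eq_one hA j hx)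
  have key : ∀ (ν : FiniteMeasure α) (j : ℕ),
      |∫ x, g x ∂(ν.restrict A : Measure α) - ∫ x, (g * φ j) x ∂(ν : Measure α)| ≤
        ‖g‖ * (∫ x, φ j x ∂(ν : Measure α) - (ν : Measure α).real A) := by
    intro ν j
    have i1 : Integrable (A.indicator fun x => g x) (ν : Measure α) :=
      (g.integrable _).indicator hA.measurableSet
    have i2 : Integrable (A.indicator fun _ => (1 : ℝ)) (ν : Measure α) :=
      (integrable_const _).indicator hA.measurableSet
    rw [FiniteMeasure.restrict_measure_eq, ← integral_indicator hA.measurableSet,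
      ← integral_indicator_one hA.measurableSet, ← integral_sub i1 ((g * φ j).integrable _)]
    erw [← integral_sub ((φ j).integrable _) i2]
    rw [← integral_const_mul, ← Real.norm_eq_abs]
    refine norm_integral_le_of_norm_le ((((φ j).integrable _).sub i2).const_mul _)
      (Eventually.of_forall fun x => ?_)
    by_cases hx : x ∈ A
    · simp [hx, hφA j x hx]
    · simp only [hx, not_false_eq_true, Set.indicator_of_notMem, zero_sub, norm_neg, sub_zero,
        BoundedContinuousFunction.mul_apply, norm_mul]
      rw [Real.norm_of_nonneg (hφ0 j x)]
      exact mul_le_mul_of_nonneg_right (g.norm_coe_le_norm x) (hφ0 j x)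
  have hlim : Tendsto (fun j => ‖g‖ * (∫ x, φ j x ∂(μ : Measure α) - (μ : Measure α).real A))
      atTop (𝓝 0) := by
    have := (ENNReal.tendsto_toReal (measure_ne_top (μ : Measure α) A)).comp
      (HasOuterApproxClosed.tendsto_lintegral_apprSeq hA (μ : Measure α))
    have h2 : Tendsto (fun j => ∫ x, φ j x ∂(μ : Measure α)) atTop
        (𝓝 ((μ : Measure α).real A)) := by
      refine this.congr fun j => ?_
      exact BoundedContinuousFunction.toReal_lintegral_coe_eq_integral _ _
    simpa using (h2.sub_const ((μ : Measure α).real A)).const_mul ‖g‖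
  rw [Metric.tendsto_nhds]
  intro ε hε
  obtain ⟨j, hj⟩ := (hlim.eventually_lt_const (half_pos (half_pos hε))).exists
  have e1 := (((h (φ j)).sub hmass').const_mul ‖g‖).eventually_lt_const hj
  have e2 := Metric.tendsto_nhds.1 (h (g * φ j)) _ (half_pos (half_pos hε))
  filter_upwards [e1, e2] with a h1 h2
  have k1 := key (κ a) j
  have k2 := key μ j
  rw [Real.dist_eq] at h2 ⊢
  rw [abs_lt] at h2 ⊢
  rw [abs_le] at k1 k2
  constructor <;> linarith [h2.1, h2.2, k1.1, k1.2, k2.1, k2.2]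

end General

/-! ### Cut-off measures and the functionals of the distance matrix. -/

section CutOff

open scoped ENNReal BoundedContinuousFunction

/-- A measure is boundedly finite if bounded sets have finite measure. -/
class IsBoundedlyFinite {α : Type*} [PseudoMetricSpace α] [MeasurableSpace α] (μ : Measure α) :
    Prop where
  measure_lt_top : ∀ s : Set α, Bornology.IsBounded s → μ s < ⊤

/-- A continuous cut-off function which is `1` on `[0, k]` and `0` on `[k + 1, ∞)`. -/
noncomputable def cutoff (k : ℕ) (t : ℝ≥0) : ℝ≥0 := min 1 ((k + 1 : ℝ≥0) - t)

theorem cutoff_le_one (k : ℕ) (t : ℝ≥0) : cutoff k t ≤ 1 := min_le_left _ _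

@[fun_prop]
theorem continuous_cutoff (k : ℕ) : Continuous (cutoff k) := by
  unfold cutoff; fun_prop

theorem cutoff_eq_zero {k : ℕ} {t : ℝ≥0} (h : (k + 1 : ℝ≥0) ≤ t) : cutoff k t = 0 := by
  simp [cutoff, tsub_eq_zero_of_le h]

theorem cutoff_pos {k : ℕ} {t : ℝ≥0} (h : t < k + 1) : 0 < cutoff k t :=
  lt_min one_pos (tsub_pos_of_lt h)

theorem cutoff_eq_one {k : ℕ} {t : ℝ≥0} (h : t ≤ k) : cutoff k t = 1 :=
  min_eq_left (le_tsub_of_add_le_left (by rw [add_comm t]; rw [add_comm (k : ℝ≥0)]; gcongr))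

/-- The index of the distance between the root and the `i`-th point. -/
def rootIndex {m : ℕ} (i : Fin m) : PointedMMSpace.PairIndex m := ⟨(0, i.succ), Fin.succ_pos i⟩

/-- The compact set of matrices with entries at most `2 (k + 1)`. -/
def distBox (m k : ℕ) : Set (PointedMMSpace.PairIndex m → ℝ≥0) := Set.Iic fun _ => 2 * (k + 1)

theorem isCompact_distBox (m k : ℕ) : IsCompact (distBox m k) := by
  rw [distBox, ← Set.Icc_bot]; exact isCompact_Icc

/-- Truncation of matrices to the set `distBox m k`. -/
noncomputable def truncMatrix (m k : ℕ) (D : PointedMMSpace.PairIndex m → ℝ≥0) :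
    PointedMMSpace.PairIndex m → ℝ≥0 := fun p => min (D p) (2 * (k + 1))

@[fun_prop]
theorem continuous_truncMatrix (m k : ℕ) : Continuous (truncMatrix m k) := by
  unfold truncMatrix; fun_prop

theorem truncMatrix_mem (m k : ℕ) (D) : truncMatrix m k D ∈ distBox m k :=
  fun _ => min_le_right _ _

theorem truncMatrix_eq {m k : ℕ} {D} (h : D ∈ distBox m k) : truncMatrix m k D = D :=
  funext fun p => min_eq_left (h p)

/-- The bounded continuous function which agrees with `f` on `distBox m k`. -/
noncomputable def truncFun {m : ℕ} (k : ℕ) (f : C(PointedMMSpace.PairIndex m → ℝ≥0, ℝ)) :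
    (PointedMMSpace.PairIndex m → ℝ≥0) →ᵇ ℝ :=
  BoundedContinuousFunction.ofNormedAddCommGroup (fun D => f (truncMatrix m k D)) (by fun_prop)
    ((isCompact_distBox m k).exists_bound_of_continuousOn f.continuous.continuousOn).choose
    fun D => ((isCompact_distBox m k).exists_bound_of_continuousOn
      f.continuous.continuousOn).choose_spec _ (truncMatrix_mem m k D)

theorem truncFun_apply {m k : ℕ} {f : C(PointedMMSpace.PairIndex m → ℝ≥0, ℝ)} {D}
    (h : D ∈ distBox m k) : truncFun k f D = f D :=
  congrArg f (truncMatrix_eq h)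

variable {α : Type*} [MetricSpace α]

/-- The distance matrix of the points `ρ, x₁, …, xₘ`. -/
noncomputable def distMat (ρ : α) (m : ℕ) (x : Fin m → α) : PointedMMSpace.PairIndex m → ℝ≥0 :=
  fun p => nndist ((Fin.cons ρ x : Fin (m + 1) → α) p.1.1) ((Fin.cons ρ x : Fin (m + 1) → α) p.1.2)

theorem distMat_rootIndex (ρ : α) {m : ℕ} (x : Fin m → α) (i : Fin m) :
    distMat ρ m x (rootIndex i) = nndist ρ (x i) := by
  simp [distMat, rootIndex]

@[fun_prop]
theorem continuous_distMat (ρ : α) (m : ℕ) : Continuous (distMat ρ m) := by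
  have hc : ∀ i : Fin (m + 1), Continuous fun x : Fin m → α => (Fin.cons ρ x : Fin (m + 1) → α) i := by
    refine Fin.cases ?_ fun j => ?_
    · simpa using continuous_const
    · simpa using continuous_apply j
  exact continuous_pi fun p => (hc _).nndist (hc _)

theorem distMat_mem_distBox {ρ : α} {m k : ℕ} {x : Fin m → α}
    (h : ∀ i, nndist ρ (x i) < k + 1) : distMat ρ m x ∈ distBox m k := by
  have h' : ∀ i : Fin (m + 1), nndist ρ ((Fin.cons ρ x : Fin (m + 1) → α) i) ≤ k + 1 := by
    refine Fin.cases ?_ fun i => ?_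
    · simp
    · simpa using (h i).le
  intro p
  refine (nndist_triangle_left _ _ ρ).trans ?_
  rw [two_mul]
  exact add_le_add (h' _) (h' _)

variable [MeasurableSpace α]

/-- The measure `μ`, cut off outside of the ball of radius `k + 1`. -/
noncomputable def rootCut (ρ : α) (μ : Measure α) (k : ℕ) : Measure α :=
  μ.withDensity fun x => (cutoff k (nndist ρ x) : ℝ≥0∞)

variable [BorelSpace α]

instance isFiniteMeasure_rootCut (ρ : α) (μ : Measure α) [IsBoundedlyFinite μ] (k : ℕ) :
    IsFiniteMeasure (rootCut ρ μ k) := by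
  refine isFiniteMeasure_withDensity (ne_of_lt ?_)
  have : ∫⁻ x, (cutoff k (nndist ρ x) : ℝ≥0∞) ∂μ ≤
      ∫⁻ x, (Metric.closedBall ρ (k + 1)).indicator 1 x ∂μ := by
    refine lintegral_mono fun x => ?_
    by_cases hx : x ∈ Metric.closedBall ρ (k + 1)
    · simpa [hx] using cutoff_le_one k _
    · rw [cutoff_eq_zero]
      · simp
      · rw [Metric.mem_closedBall, dist_comm, not_le] at hx
        rw [← NNReal.coe_le_coe]
        exact_mod_cast hx.le
  rw [lintegral_indicator_one Metric.isClosed_closedBall.measurableSet] at this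
  exact this.trans_lt (IsBoundedlyFinite.measure_lt_top _ Metric.isBounded_closedBall)

theorem rootCut_ae (ρ : α) (μ : Measure α) (k : ℕ) :
    ∀ᵐ x ∂(rootCut ρ μ k), nndist ρ x < k + 1 := by
  rw [rootCut, ae_withDensity_iff (by fun_prop)]
  refine Eventually.of_forall fun x hx => ?_
  by_contra h
  exact hx (by simp [cutoff_eq_zero (not_lt.1 h)])

/-- The cut-off measure as a finite measure. -/
noncomputable def rootCutFinite (ρ : α) (μ : Measure α) [IsBoundedlyFinite μ] (k : ℕ) :
    FiniteMeasure α := ⟨rootCut ρ μ k, inferInstance⟩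

/-- The law of the distance matrix of the root and `m` points sampled with the measure
`rootCut ρ μ k`. -/
noncomputable def distLaw (ρ : α) (μ : Measure α) [IsBoundedlyFinite μ] (m k : ℕ) :
    FiniteMeasure (PointedMMSpace.PairIndex m → ℝ≥0) :=
  (FiniteMeasure.pi fun _ : Fin m => rootCutFinite ρ μ k).map
    (distMat ρ m)

/-- The integral of `f` with respect to the law of the cut-off distance matrix. -/
noncomputable def distFunctional (ρ : α) (μ : Measure α) [IsBoundedlyFinite μ] (m k : ℕ)
    (f : C(PointedMMSpace.PairIndex m → ℝ≥0, ℝ)) : ℝ :=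
  ∫ D, f D ∂(distLaw ρ μ m k : Measure (PointedMMSpace.PairIndex m → ℝ≥0))

theorem distLaw_toMeasure (ρ : α) (μ : Measure α) [IsBoundedlyFinite μ] (m k : ℕ) :
    (distLaw ρ μ m k : Measure (PointedMMSpace.PairIndex m → ℝ≥0)) =
      (Measure.pi fun _ : Fin m => rootCut ρ μ k).map (distMat ρ m) := rfl

variable [TopologicalSpace.SeparableSpace α]

instance sigmaFinite_of_isBoundedlyFinite (μ : Measure α) [IsBoundedlyFinite μ] :
    SigmaFinite μ := by
  have := UniformSpace.secondCountable_of_separable α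
  have : IsLocallyFiniteMeasure μ := ⟨fun x => ⟨Metric.ball x 1, Metric.ball_mem_nhds x one_pos,
    IsBoundedlyFinite.measure_lt_top _ Metric.isBounded_ball⟩⟩
  infer_instance

instance opensMeasurable_pi_of_separable (m : ℕ) : BorelSpace (Fin m → α) := by
  have := UniformSpace.secondCountable_of_separable α
  infer_instance

theorem distFunctional_eq (ρ : α) (μ : Measure α) [IsBoundedlyFinite μ] (m k : ℕ)
    (f : C(PointedMMSpace.PairIndex m → ℝ≥0, ℝ)) :
    distFunctional ρ μ m k f =
      ∫ x, f (distMat ρ m x) ∂(Measure.pi fun _ : Fin m => rootCut ρ μ k) := by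
  rw [distFunctional, distLaw_toMeasure,
    integral_map (by fun_prop) f.continuous.aestronglyMeasurable]

theorem pi_rootCut_ae (ρ : α) (μ : Measure α) [IsBoundedlyFinite μ] (m k : ℕ) :
    ∀ᵐ x ∂(Measure.pi fun _ : Fin m => rootCut ρ μ k), ∀ i, nndist ρ (x i) < k + 1 :=
  eventually_all.2 fun i => (Measure.tendsto_eval_ae_ae (μ := fun _ : Fin m => rootCut ρ μ k)
    (i := i)).eventually (rootCut_ae ρ μ k)

theorem distLaw_ae (ρ : α) (μ : Measure α) [IsBoundedlyFinite μ] (m k : ℕ) :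
    ∀ᵐ D ∂(distLaw ρ μ m k : Measure (PointedMMSpace.PairIndex m → ℝ≥0)), D ∈ distBox m k := by
  refine (ae_map_iff (f := distMat ρ m) (p := fun D => D ∈ distBox m k) (by fun_prop)
    (isCompact_distBox m k).isClosed.measurableSet).2 ?_
  exact (pi_rootCut_ae ρ μ m k).mono fun x hx => distMat_mem_distBox hx

theorem integrable_distLaw (ρ : α) (μ : Measure α) [IsBoundedlyFinite μ] (m k : ℕ)
    (f : C(PointedMMSpace.PairIndex m → ℝ≥0, ℝ)) :
    Integrable (fun D => f D)
      (distLaw ρ μ m k : Measure (PointedMMSpace.PairIndex m → ℝ≥0)) :=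
  ((truncFun k f).integrable _).congr ((distLaw_ae ρ μ m k).mono fun _ hD => truncFun_apply hD)

/-- Convergence of the functionals is weak convergence of the cut-off distance matrix laws. -/
theorem tendsto_distLaw_iff {ι : Type*} {l : Filter ι} {m k : ℕ}
    {κ : ι → FiniteMeasure (PointedMMSpace.PairIndex m → ℝ≥0)}
    {κ' : FiniteMeasure (PointedMMSpace.PairIndex m → ℝ≥0)}
    (hκ : ∀ a, ∀ᵐ D ∂(κ a : Measure (PointedMMSpace.PairIndex m → ℝ≥0)), D ∈ distBox m k)
    (hκ' : ∀ᵐ D ∂(κ' : Measure (PointedMMSpace.PairIndex m → ℝ≥0)), D ∈ distBox m k) :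
    Tendsto κ l (𝓝 κ') ↔ ∀ f : C(PointedMMSpace.PairIndex m → ℝ≥0, ℝ),
      Tendsto (fun a => ∫ D, f D ∂(κ a : Measure (PointedMMSpace.PairIndex m → ℝ≥0))) l
        (𝓝 (∫ D, f D ∂(κ' : Measure (PointedMMSpace.PairIndex m → ℝ≥0)))) := by
  rw [FiniteMeasure.tendsto_iff_forall_integral_tendsto]
  refine ⟨fun h f => ?_, fun h f => h f.toContinuousMap⟩
  have e : ∀ ν : Measure (PointedMMSpace.PairIndex m → ℝ≥0), (∀ᵐ D ∂ν, D ∈ distBox m k) →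
      ∫ D, truncFun k f D ∂ν = ∫ D, f D ∂ν := fun ν hν =>
    integral_congr_ae (hν.mono fun _ hD => truncFun_apply hD)
  have := h (truncFun k f)
  rw [e _ hκ'] at this
  exact this.congr fun a => e _ (hκ a)

/-- On a fixed space, weak convergence of the cut-off measures implies convergence of the
functionals. -/
theorem tendsto_distFunctional {ι : Type*} {l : Filter ι} (ρ : α) (κ : ι → Measure α)
    (μ : Measure α) [∀ a, IsBoundedlyFinite (κ a)] [IsBoundedlyFinite μ] (k : ℕ)
    (h : ∀ g : α →ᵇ ℝ, Tendsto (fun a => ∫ x, g x ∂(rootCut ρ (κ a) k)) l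
      (𝓝 (∫ x, g x ∂(rootCut ρ μ k)))) (m : ℕ) (f : C(PointedMMSpace.PairIndex m → ℝ≥0, ℝ)) :
    Tendsto (fun a => distFunctional ρ (κ a) m k f) l (𝓝 (distFunctional ρ μ m k f)) := by
  have := UniformSpace.secondCountable_of_separable α
  have h1 : Tendsto (fun a => rootCutFinite ρ (κ a) k) l (𝓝 (rootCutFinite ρ μ k)) :=
    FiniteMeasure.tendsto_iff_forall_integral_tendsto.2 h
  have h2 := FiniteMeasure.tendsto_map_of_tendsto_of_continuous _ _
    (FiniteMeasure.tendsto_pi m h1) (continuous_distMat ρ m)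
  exact (tendsto_distLaw_iff (fun a => distLaw_ae ρ (κ a) m k) (distLaw_ae ρ μ m k)).1 h2 f

theorem integral_rootCut (ρ : α) (μ : Measure α) [IsBoundedlyFinite μ] (k : ℕ) (g : α → ℝ) :
    ∫ x, g x ∂(rootCut ρ μ k) = ∫ x, (cutoff k (nndist ρ x) : ℝ) * g x ∂μ := by
  rw [rootCut, integral_withDensity_eq_integral_smul (by fun_prop)]
  rfl

/-- The functional as an integral over the product of the measure itself. -/
theorem distFunctional_eq_integral_pi (ρ : α) (μ : Measure α) [IsBoundedlyFinite μ] (m k : ℕ)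
    (f : C(PointedMMSpace.PairIndex m → ℝ≥0, ℝ)) :
    distFunctional ρ μ m k f =
      ∫ x, ((∏ i, cutoff k (nndist ρ (x i)) : ℝ≥0) : ℝ) * f (distMat ρ m x)
        ∂(Measure.pi fun _ : Fin m => μ) := by
  rw [distFunctional_eq]
  simp_rw [rootCut]
  rw [pi_withDensity _ _ (by fun_prop), integral_withDensity_eq_integral_smul (by fun_prop)]
  rfl

end CutOff

/-! ### Gromov-vague convergence as convergence of functionals. -/

section GromovVague

open scoped ENNReal BoundedContinuousFunction

section Generic

variable {α : Type*} [MetricSpace α] [MeasurableSpace α] [BorelSpace α]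

/-- The cut-off vanishes beyond radius `k + 1`. With `restrict_rootCut`, this translates between
sharp and continuous truncation in both directions. -/
theorem rootCut_restrict_closedBall (ρ : α) (μ : Measure α) (k : ℕ) {R : ℝ} (hR : (k + 1 : ℝ) ≤ R) :
    rootCut ρ (μ.restrict (Metric.closedBall ρ R)) k = rootCut ρ μ k := by
  rw [rootCut, ← restrict_withDensity Metric.isClosed_closedBall.measurableSet]
  refine Measure.restrict_eq_self_of_ae_mem ((rootCut_ae ρ μ k).mono fun x hx => ?_)
  rw [Metric.mem_closedBall, dist_comm]
  refine le_trans ?_ hR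
  exact_mod_cast (NNReal.coe_lt_coe.2 hx).le

theorem restrict_rootCut (ρ : α) (μ : Measure α) (k : ℕ) {R : ℝ} (hR : R ≤ k) :
    (rootCut ρ μ k).restrict (Metric.closedBall ρ R) = μ.restrict (Metric.closedBall ρ R) := by
  have hB : MeasurableSet (Metric.closedBall ρ R) := Metric.isClosed_closedBall.measurableSet
  rw [rootCut, restrict_withDensity hB]
  conv_rhs => rw [← withDensity_one (μ := μ.restrict _)]
  refine withDensity_congr_ae ((ae_restrict_iff' hB).2 (Eventually.of_forall fun x hx => ?_))
  rw [Metric.mem_closedBall, dist_comm] at hx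
  have : nndist ρ x ≤ k := by rw [← NNReal.coe_le_coe]; exact hx.trans hR
  simp [cutoff_eq_one this]

/-- Spheres of different radii are disjoint, so a σ-finite measure charges only countably many. -/
theorem exists_null_sphere (ρ : α) (μ : Measure α) [SigmaFinite μ] (r : ℝ) :
    ∃ R, r < R ∧ μ (Metric.sphere ρ R) = 0 := by
  have hc : Set.Countable {R : ℝ | 0 < μ (Metric.sphere ρ R)} :=
    Measure.countable_meas_pos_of_disjoint_iUnion
      (fun R => Metric.isClosed_sphere.measurableSet) fun R R' h =>
        Set.disjoint_left.2 fun x hx hx' => h (hx.symm.trans hx')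
  obtain ⟨R, hR, hr⟩ := (hc.dense_compl ℝ).exists_gt r
  exact ⟨R, hr, by simpa using hR⟩

variable [TopologicalSpace.SeparableSpace α]

/-- The bounded continuous function whose integrals with respect to the distance matrix
distribution of a finite measure are given by `distFunctional`. -/
noncomputable def cutFun {m : ℕ} (k : ℕ) (f : C(PointedMMSpace.PairIndex m → ℝ≥0, ℝ)) :
    (PointedMMSpace.PairIndex m → ℝ≥0) →ᵇ ℝ :=
  BoundedContinuousFunction.ofNormedAddCommGroup
    (fun D => ((∏ i : Fin m, cutoff k (D (rootIndex i)) : ℝ≥0) : ℝ) * truncFun k f D)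
    (by fun_prop) ‖truncFun k f‖ fun D => by
      rw [norm_mul]
      refine (mul_le_of_le_one_left (norm_nonneg _) ?_).trans ((truncFun k f).norm_coe_le_norm D)
      rw [NNReal.norm_eq]
      exact_mod_cast Finset.prod_le_one' fun i _ => cutoff_le_one k _

/-- The cut-off factors are functions of the root row of the matrix. Where all of them are positive,
the matrix lies in `distBox m k` and truncating `f` changes nothing; elsewhere both sides vanish.
The functional is thus the integral of a bounded continuous function of the matrix. -/
theorem distFunctional_eq_integral_map (ρ : α) (μ : Measure α) [IsBoundedlyFinite μ]
    (m k : ℕ) (f : C(PointedMMSpace.PairIndex m → ℝ≥0, ℝ)) :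
    distFunctional ρ μ m k f =
      ∫ D, cutFun k f D ∂((Measure.pi fun _ : Fin m => μ).map (distMat ρ m)) := by
  rw [integral_map (by fun_prop) (cutFun k f).continuous.aestronglyMeasurable,
    distFunctional_eq_integral_pi]
  refine integral_congr_ae (Eventually.of_forall fun x => ?_)
  change _ = ((∏ i : Fin m, cutoff k (distMat ρ m x (rootIndex i)) : ℝ≥0) : ℝ) * truncFun k f _
  simp_rw [distMat_rootIndex]
  by_cases h : ∀ i, nndist ρ (x i) < k + 1
  · rw [truncFun_apply (distMat_mem_distBox h)]
  · push Not at h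
    obtain ⟨i, hi⟩ := h
    rw [Finset.prod_eq_zero (Finset.mem_univ i) (cutoff_eq_zero hi)]
    simp

/-- The matrices whose distances to the root are at most `R`. -/
def rootBall (m : ℕ) (R : ℝ) : Set (PointedMMSpace.PairIndex m → ℝ≥0) :=
  {D | ∀ i : Fin m, (D (rootIndex i) : ℝ) ≤ R}

theorem isClosed_rootBall (m : ℕ) (R : ℝ) : IsClosed (rootBall m R) := by
  simp only [rootBall, Set.ofPred_forall]
  exact isClosed_iInter fun i => isClosed_le (by fun_prop) continuous_const

theorem map_pi_restrict_closedBall (ρ : α) (μ : Measure α) [IsBoundedlyFinite μ] (m k : ℕ) {R : ℝ}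
    (hR : R ≤ k) :
    (Measure.pi fun _ : Fin m => μ.restrict (Metric.closedBall ρ R)).map (distMat ρ m) =
      (distLaw ρ μ m k : Measure (PointedMMSpace.PairIndex m → ℝ≥0)).restrict (rootBall m R) := by
  rw [distLaw_toMeasure, Measure.restrict_map (by fun_prop) (isClosed_rootBall m R).measurableSet,
    ← restrict_rootCut ρ μ k hR, ← Measure.restrict_pi_pi]
  congr 2
  ext x
  simp [rootBall, distMat_rootIndex, dist_comm]

/-- On the frontier some sampled point lies exactly on the sphere of radius `R`, which is null also
for the cut-off measure. -/
theorem distLaw_frontier_rootBall (ρ : α) (μ : Measure α) [IsBoundedlyFinite μ] (m k : ℕ) {R : ℝ}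
    (hR : μ (Metric.sphere ρ R) = 0) :
    (distLaw ρ μ m k : Measure (PointedMMSpace.PairIndex m → ℝ≥0)) (frontier (rootBall m R)) = 0 := by
  have hsub : frontier (rootBall m R) ⊆ {D | ∃ i : Fin m, (D (rootIndex i) : ℝ) = R} := by
    intro D hD
    by_contra hne
    rw [(isClosed_rootBall m R).frontier_eq] at hD
    refine hD.2 (mem_interior.2 ⟨{D | ∀ i : Fin m, (D (rootIndex i) : ℝ) < R},
      fun D' h' i => (h' i).le, ?_, fun i => lt_of_le_of_ne (hD.1 i) fun h => hne ⟨i, h⟩⟩)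
    simp only [Set.ofPred_forall]
    exact isOpen_iInter_of_finite fun i => isOpen_lt (by fun_prop) continuous_const
  refine measure_mono_null hsub ?_
  rw [distLaw_toMeasure, Measure.map_apply (by fun_prop)]
  · have h0 : rootCut ρ μ k (Metric.sphere ρ R) = 0 :=
      withDensity_absolutelyContinuous _ _ hR
    have h1 : ∀ᵐ x ∂(rootCut ρ μ k), x ∉ Metric.sphere ρ R := measure_eq_zero_iff_ae_notMem.1 h0
    have h2 : ∀ᵐ x ∂(Measure.pi fun _ : Fin m => rootCut ρ μ k), ∀ i, x i ∉ Metric.sphere ρ R :=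
      eventually_all.2 fun i => (Measure.tendsto_eval_ae_ae (μ := fun _ : Fin m => rootCut ρ μ k)
        (i := i)).eventually h1
    refine measure_mono_null (fun x hx => ?_) (ae_iff.1 h2)
    obtain ⟨i, hi⟩ := hx
    rw [distMat_rootIndex] at hi
    simp only [Set.mem_ofPred_eq, not_forall, not_not]
    exact ⟨i, by rw [Metric.mem_sphere, dist_comm]; exact hi⟩
  · simp only [Set.ofPred_exists]
    exact MeasurableSet.iUnion fun i => (isClosed_eq (by fun_prop) continuous_const).measurableSet

end Generic

namespace PointedMMSpace

instance isBoundedlyFinite_measure (X : PointedMMSpace) : IsBoundedlyFinite X.measure :=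
  ⟨X.boundedlyFinite⟩

/-- The integral of `f` with respect to the law of the cut-off distance matrix. -/
noncomputable def functional (X : PointedMMSpace) (m k : ℕ) (f : C(PairIndex m → ℝ≥0, ℝ)) : ℝ :=
  distFunctional X.root X.measure m k f

theorem distMatrixDistribution_restrictBall (X : PointedMMSpace) (R : ℝ) (m : ℕ) :
    ((X.restrictBall R).distMatrixDistribution m : Measure (PairIndex m → ℝ≥0)) =
      (Measure.pi fun _ : Fin m => X.measure.restrict (Metric.closedBall X.root R)).map
        (distMat X.root m) := rfl

theorem functional_eq_integral_restrictBall (X : PointedMMSpace) {R : ℝ} {k : ℕ}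
    (hR : (k + 1 : ℝ) ≤ R) (m : ℕ) (f : C(PairIndex m → ℝ≥0, ℝ)) :
    X.functional m k f = ∫ D, cutFun k f D
      ∂((X.restrictBall R).distMatrixDistribution m : Measure (PairIndex m → ℝ≥0)) := by
  have : IsBoundedlyFinite (X.measure.restrict (Metric.closedBall X.root R)) :=
    ⟨fun s hs => (Measure.restrict_apply_le _ s).trans_lt (X.boundedlyFinite s hs)⟩
  rw [distMatrixDistribution_restrictBall, ← distFunctional_eq_integral_map, functional,
    distFunctional_eq, distFunctional_eq, rootCut_restrict_closedBall _ _ _ hR]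

/-- Gromov-vague convergence is convergence of all functionals. -/
theorem gromovVagueTendsto_iff {Xs : ℕ → PointedMMSpace} {X : PointedMMSpace} :
    GromovVagueTendsto Xs X ↔ ∀ (m k : ℕ) (f : C(PairIndex m → ℝ≥0, ℝ)),
      Tendsto (fun n => (Xs n).functional m k f) atTop (𝓝 (X.functional m k f)) := by
  constructor
  · intro h m k f
    -- Any admissible radius beyond `k + 1` leaves the cut-off measure unchanged.
    obtain ⟨R, hkR, hR⟩ := exists_null_sphere X.root X.measure (k + 1 : ℝ)
    have := FiniteMeasure.tendsto_iff_forall_integral_tendsto.1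
      (h R (lt_trans (by positivity) hkR) hR m) (cutFun k f)
    simp_rw [functional_eq_integral_restrictBall _ hkR.le]
    exact this
  · intro h R _ hR m
    -- For `k ≥ R` the cut-off is one on the ball, so the sharp restriction is recovered by
    -- restricting the cut-off law to `rootBall m R`.
    obtain ⟨k, hk⟩ := exists_nat_ge R
    have h1 : Tendsto (fun n => distLaw (Xs n).root (Xs n).measure m k) atTop
        (𝓝 (distLaw X.root X.measure m k)) :=
      (tendsto_distLaw_iff (fun a => distLaw_ae _ _ m k) (distLaw_ae _ _ m k)).2 fun f => h m k f
    have h2 := FiniteMeasure.tendsto_restrict h1 (isClosed_rootBall m R)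
      (distLaw_frontier_rootBall X.root X.measure m k hR)
    have e : ∀ Y : PointedMMSpace, (Y.restrictBall R).distMatrixDistribution m =
        (distLaw Y.root Y.measure m k).restrict (rootBall m R) := fun Y =>
      Subtype.ext (map_pi_restrict_closedBall Y.root Y.measure m k hk)
    rw [e X]
    exact h2.congr fun n => (e (Xs n)).symm

end PointedMMSpace

end GromovVague

/-! ### Invariance of the functionals and the topology induced by countably many of them. -/

section Topology

open scoped ENNReal BoundedContinuousFunction

section Invariance

variable {α β : Type*} [MetricSpace α] [MeasurableSpace α] [BorelSpace α]
  [MetricSpace β] [MeasurableSpace β] [BorelSpace β]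

theorem rootCut_map {φ : α → β} (hφ : Isometry φ) (ρ : α) (μ : Measure α) (k : ℕ) :
    rootCut (φ ρ) (μ.map φ) k = (rootCut ρ μ k).map φ := by
  have hm : Measurable φ := hφ.continuous.measurable
  ext s hs
  rw [Measure.map_apply hm hs, rootCut, rootCut, withDensity_apply _ hs,
    withDensity_apply _ (hm hs), setLIntegral_map hs (by fun_prop) hm]
  simp_rw [hφ.nndist_eq]

variable [TopologicalSpace.SeparableSpace α] [TopologicalSpace.SeparableSpace β]

/-- The functionals are invariant under root preserving isometric embeddings. -/
theorem distFunctional_map {φ : α → β} (hφ : Isometry φ) (ρ : α) (μ : Measure α)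
    [IsBoundedlyFinite μ] [IsBoundedlyFinite (μ.map φ)] (m k : ℕ)
    (f : C(PointedMMSpace.PairIndex m → ℝ≥0, ℝ)) :
    distFunctional (φ ρ) (μ.map φ) m k f = distFunctional ρ μ m k f := by
  have hm : Measurable φ := hφ.continuous.measurable
  rw [distFunctional_eq, distFunctional_eq, rootCut_map hφ]
  have : IsFiniteMeasure ((rootCut ρ μ k).map φ) := inferInstance
  rw [← Measure.pi_map_pi (fun _ => hm.aemeasurable), integral_map]
  · refine integral_congr_ae (Eventually.of_forall fun x => congrArg f (funext fun p => ?_))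
    have h : ∀ i : Fin (m + 1), (Fin.cons (φ ρ) (fun i => φ (x i)) : Fin (m + 1) → β) i =
        φ ((Fin.cons ρ x : Fin (m + 1) → α) i) := Fin.cases rfl fun _ => rfl
    simp only [distMat, h, hφ.nndist_eq]
  · exact (measurable_pi_lambda _ fun i => hm.comp (measurable_pi_apply i)).aemeasurable
  · exact (f.continuous.comp (continuous_distMat _ _)).aestronglyMeasurable

end Invariance

namespace PointedMMSpace

theorem isClosed_core (X : PointedMMSpace) : IsClosed X.core :=
  Measure.isClosed_support.union isClosed_singleton

theorem secondCountable (X : PointedMMSpace) : SecondCountableTopology X.carrier :=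
  UniformSpace.secondCountable_of_separable _

theorem measure_compl_core (X : PointedMMSpace) : X.measure X.coreᶜ = 0 := by
  have := X.secondCountable
  exact measure_mono_null (Set.compl_subset_compl.2 Set.subset_union_left)
    Measure.measure_compl_support

theorem coreMeasure_map_val (X : PointedMMSpace) :
    X.coreMeasure.map Subtype.val = X.measure := by
  rw [coreMeasure, (MeasurableEmbedding.subtype_coe X.isClosed_core.measurableSet).map_comap,
    Subtype.range_coe]
  exact Measure.restrict_eq_self_of_ae_mem (mem_ae_iff.2 X.measure_compl_core)

/-- The space `supp(μ) ∪ {ρ}` as a pointed metric measure space. -/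
noncomputable def coreSpace (X : PointedMMSpace) : PointedMMSpace where
  carrier := X.core
  completeSpace := X.isClosed_core.completeSpace_coe
  separableSpace := by have := X.secondCountable; infer_instance
  root := ⟨X.root, X.root_mem_core⟩
  measure := X.coreMeasure
  boundedlyFinite s hs := by
    rw [coreMeasure, (MeasurableEmbedding.subtype_coe X.isClosed_core.measurableSet).comap_apply]
    exact X.boundedlyFinite _ ((LipschitzWith.subtype_val X.core).isBounded_image hs)

theorem functional_coreSpace (X : PointedMMSpace) (m k : ℕ) (f : C(PairIndex m → ℝ≥0, ℝ)) :
    X.coreSpace.functional m k f = X.functional m k f := by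
  have h : IsBoundedlyFinite X.coreMeasure := X.coreSpace.isBoundedlyFinite_measure
  have h' : IsBoundedlyFinite (X.coreMeasure.map Subtype.val) := by
    rw [coreMeasure_map_val]; infer_instance
  have := X.secondCountable
  have := distFunctional_map (β := X.carrier) isometry_subtype_coe (⟨X.root, X.root_mem_core⟩ : X.core)
    X.coreMeasure m k f
  simp only [coreMeasure_map_val] at this
  exact this.symm

theorem functional_eq_of_equivalent {X Y : PointedMMSpace} (h : Equivalent X Y) (m k : ℕ)
    (f : C(PairIndex m → ℝ≥0, ℝ)) : X.functional m k f = Y.functional m k f := by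
  obtain ⟨φ, hρ, hμ⟩ := h
  rw [← functional_coreSpace X, ← functional_coreSpace Y]
  have := X.secondCountable
  have := Y.secondCountable
  have h : IsBoundedlyFinite X.coreMeasure := X.coreSpace.isBoundedlyFinite_measure
  have h' : IsBoundedlyFinite Y.coreMeasure := Y.coreSpace.isBoundedlyFinite_measure
  have h'' : IsBoundedlyFinite (X.coreMeasure.map φ) := by rw [hμ]; infer_instance
  have := distFunctional_map φ.isometry (⟨X.root, X.root_mem_core⟩ : X.core) X.coreMeasure m k f
  simp only [hρ, hμ] at this
  exact this.symm

/-- A countable family of test functions: the constant `1` and a dense sequence. -/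
noncomputable def testFun (m : ℕ) : ℕ → C(PairIndex m → ℝ≥0, ℝ)
  | 0 => 1
  | j + 1 => TopologicalSpace.denseSeq _ j

/-- The values of the functionals at the test functions. -/
noncomputable def coord (X : PointedMMSpace) : ℕ × ℕ × ℕ → ℝ :=
  fun i => X.functional i.1 i.2.1 (testFun i.1 i.2.2)

theorem functional_one (X : PointedMMSpace) (m k : ℕ) :
    X.functional m k 1 =
      (distLaw X.root X.measure m k : Measure (PairIndex m → ℝ≥0)).real Set.univ := by
  simp [functional, distFunctional]

theorem abs_functional_sub_le (X : PointedMMSpace) {m k : ℕ} {f g : C(PairIndex m → ℝ≥0, ℝ)} {ε : ℝ}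
    (h : ∀ D ∈ distBox m k, |f D - g D| ≤ ε) :
    |X.functional m k f - X.functional m k g| ≤ ε * X.functional m k 1 := by
  rw [functional_one, functional, functional, distFunctional, distFunctional,
    ← integral_sub (integrable_distLaw _ _ _ _ _) (integrable_distLaw _ _ _ _ _), mul_comm,
    ← Real.norm_eq_abs, ← smul_eq_mul]
  refine (norm_integral_le_of_norm_le_const (C := ε) ?_).trans_eq (by rw [smul_eq_mul, mul_comm])
  exact (distLaw_ae _ _ m k).mono h

theorem functional_one_nonneg (X : PointedMMSpace) (m k : ℕ) : 0 ≤ X.functional m k 1 := by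
  rw [functional_one]; exact measureReal_nonneg

/-- Density in the compact-open topology is uniform approximation on the compact set `distBox m k`,
which carries all the laws. -/
theorem exists_testFun_near {m : ℕ} (k : ℕ) (f : C(PairIndex m → ℝ≥0, ℝ)) {ε : ℝ} (hε : 0 < ε) :
    ∃ j, ∀ D ∈ distBox m k, |f D - testFun m j D| ≤ ε := by
  have hU : {g : C(PairIndex m → ℝ≥0, ℝ) | ∀ D ∈ distBox m k, dist (f D) (g D) < ε} ∈ 𝓝 f := by
    have := ContinuousMap.tendsto_iff_forall_isCompact_tendstoUniformlyOn.1
      (tendsto_id (α := C(PairIndex m → ℝ≥0, ℝ)) (x := 𝓝 f)) _ (isCompact_distBox m k)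
    exact Metric.tendstoUniformlyOn_iff.1 this ε hε
  obtain ⟨_, ⟨j, rfl⟩, hg⟩ := (TopologicalSpace.denseRange_denseSeq _).inter_nhds_nonempty hU
  exact ⟨j + 1, fun D hD => (hg D hD).le⟩

/-- Convergence of the coordinates implies convergence of all functionals. -/
theorem tendsto_functional_of_tendsto_coord {ι : Type*} {l : Filter ι} {Xs : ι → PointedMMSpace}
    {X : PointedMMSpace} (h : Tendsto (fun a => (Xs a).coord) l (𝓝 X.coord)) (m k : ℕ)
    (f : C(PairIndex m → ℝ≥0, ℝ)) :
    Tendsto (fun a => (Xs a).functional m k f) l (𝓝 (X.functional m k f)) := by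
  have hj : ∀ j, Tendsto (fun a => (Xs a).functional m k (testFun m j)) l
      (𝓝 (X.functional m k (testFun m j))) := fun j => (tendsto_pi_nhds.1 h) (m, k, j)
  rw [Metric.tendsto_nhds]
  intro ε hε
  -- Since `testFun m 0` is the constant `1`, the total masses converge and are eventually below
  -- `M`, which makes the approximation by `testFun m j` uniform along the filter.
  set M := X.functional m k 1 + 1
  have hM : 0 < M := by have := X.functional_one_nonneg m k; positivity
  obtain ⟨j, hj'⟩ := exists_testFun_near k f (ε := ε / (4 * M)) (by positivity)
  filter_upwards [(hj 0).eventually_lt_const (lt_add_one _), Metric.tendsto_nhds.1 (hj j) (ε / 2)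
    (by positivity)] with a h1 h2
  have b : ∀ Y : PointedMMSpace, Y.functional m k 1 ≤ M →
      |Y.functional m k f - Y.functional m k (testFun m j)| ≤ ε / 4 := fun Y hY => by
    refine (Y.abs_functional_sub_le hj').trans ?_
    calc ε / (4 * M) * Y.functional m k 1 ≤ ε / (4 * M) * M := by gcongr
      _ = ε / 4 := by field_simp
  have b1 := abs_le.1 (b (Xs a) h1.le)
  have b2 := abs_le.1 (b X (le_add_of_nonneg_right zero_le_one))
  rw [Real.dist_eq, abs_lt] at *
  constructor <;> linarith [b1.1, b1.2, b2.1, b2.2, h2.1, h2.2]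

theorem gromovVagueTendsto_iff_coord {Xs : ℕ → PointedMMSpace} {X : PointedMMSpace} :
    GromovVagueTendsto Xs X ↔ Tendsto (fun n => (Xs n).coord) atTop (𝓝 X.coord) := by
  rw [gromovVagueTendsto_iff]
  exact ⟨fun h => tendsto_pi_nhds.2 fun i => h _ _ _, fun h => tendsto_functional_of_tendsto_coord h⟩

theorem functional_eq_of_coord_eq {X Y : PointedMMSpace} (h : X.coord = Y.coord) (m k : ℕ)
    (f : C(PairIndex m → ℝ≥0, ℝ)) : X.functional m k f = Y.functional m k f :=
  tendsto_nhds_unique (l := (atTop : Filter ℕ)) tendsto_const_nhds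
    (tendsto_functional_of_tendsto_coord (Xs := fun _ => X) (by rw [h]; exact tendsto_const_nhds)
      m k f)

end PointedMMSpace

namespace MMSpace

/-- The values of the functionals at the test functions. -/
noncomputable def coord (x : MMSpace) : ℕ × ℕ × ℕ → ℝ :=
  Quotient.lift PointedMMSpace.coord
    (fun _ _ h => funext fun _ => PointedMMSpace.functional_eq_of_equivalent h _ _ _) x

theorem coord_mk (X : PointedMMSpace) : (mk X).coord = X.coord := rfl

theorem exists_mk (x : MMSpace) : ∃ X, mk X = x := Quotient.exists_rep x

/-- The Gromov-vague topology is induced by the coordinates. -/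
theorem isInducing_coord : IsInducing MMSpace.coord := by
  refine ⟨TopologicalSpace.ext_iff_isClosed.2 fun s => ?_⟩
  let t := TopologicalSpace.induced coord (inferInstance : TopologicalSpace (ℕ × ℕ × ℕ → ℝ))
  -- The Gromov-vague topology is defined by sequences; the induced topology is determined by its
  -- sequences because it is first countable.
  have : @FirstCountableTopology MMSpace t := TopologicalSpace.firstCountableTopology_induced _ _ _
  constructor
  · intro hs
    refine @IsSeqClosed.isClosed _ t _ _ fun x p hx hxp => ?_
    have hxp' : Tendsto (fun n => (x n).coord) atTop (𝓝 p.coord) := by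
      rw [nhds_induced, tendsto_comap_iff] at hxp; exact hxp
    by_contra hp
    choose Xs hXs using fun n => (x n).exists_mk
    obtain ⟨X, rfl⟩ := p.exists_mk
    have hU : ∀ᶠ n in atTop, mk (Xs n) ∈ sᶜ := hs.isOpen_compl Xs X
      (PointedMMSpace.gromovVagueTendsto_iff_coord.2 (by simpa only [← hXs, coord_mk] using hxp')) hp
    obtain ⟨n, hn⟩ := hU.exists
    exact hn (by rw [hXs]; exact hx n)
  · intro hs
    obtain ⟨V, hV, hVs⟩ := (@isOpen_compl_iff _ _ t).2 hs
    refine (@isOpen_compl_iff _ _ gromovVagueTopology).1 ?_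
    rw [← hVs]
    intro Xs X h hX
    exact (PointedMMSpace.gromovVagueTendsto_iff_coord.1 h).eventually (hV.mem_nhds hX)

end MMSpace

end Topology

/-! ### Random samples, their distance matrices and their empirical measures. -/

section Sampling

open scoped ENNReal BoundedContinuousFunction

/-- Two complete spaces with dense families with equal distances are isometric. -/
theorem exists_isometryEquiv_of_denseRange {ι A B : Type*} [MetricSpace A] [CompleteSpace A]
    [MetricSpace B] [CompleteSpace B] {u : ι → A} {v : ι → B} (hu : DenseRange u)
    (hv : DenseRange v) (h : ∀ i j, dist (u i) (u j) = dist (v i) (v j)) :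
    ∃ φ : A ≃ᵢ B, ∀ i, φ (u i) = v i := by
  -- Both spaces are completions of the index set with the common pseudometric, and completions are
  -- unique.
  let : PseudoMetricSpace ι := PseudoMetricSpace.induced u inferInstance
  have iu : Isometry u := Isometry.of_dist_eq fun _ _ => rfl
  have iv : Isometry v := Isometry.of_dist_eq fun i j => (h i j).symm
  let a : AbstractCompletion ι := ⟨A, u, inferInstance, inferInstance, inferInstance,
    iu.isUniformInducing, hu⟩
  let b : AbstractCompletion ι := ⟨B, v, inferInstance, inferInstance, inferInstance,
    iv.isUniformInducing, hv⟩
  let e : A ≃ᵤ B := a.compareEquiv b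
  have he : ∀ i, e (u i) = v i := fun i => a.compare_coe b i
  refine ⟨IsometryEquiv.mk e.toEquiv (Isometry.of_dist_eq fun x y => ?_), he⟩
  refine hu.induction_on₂ (p := fun x y => dist (e x) (e y) = dist x y) ?_ (fun i j => ?_) x y
  · exact isClosed_eq (by have := e.continuous; fun_prop) continuous_dist
  · rw [he, he, h]

/-- The root followed by a sequence. -/
def rootCons {α : Type*} (ρ : α) (x : ℕ → α) : ℕ → α
  | 0 => ρ
  | i + 1 => x i

/-- The infinite distance matrix of the root and a sequence of points. -/
noncomputable def seqMat {α : Type*} [MetricSpace α] (ρ : α) (x : ℕ → α) :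
    {p : ℕ × ℕ // p.1 < p.2} → ℝ≥0 :=
  fun p => nndist (rootCons ρ x p.1.1) (rootCons ρ x p.1.2)

theorem continuous_seqMat {α : Type*} [MetricSpace α] (ρ : α) : Continuous (seqMat ρ) := by
  have hc : ∀ i, Continuous fun x : ℕ → α => rootCons ρ x i := by
    rintro (_ | i)
    · exact continuous_const
    · exact continuous_apply i
  exact continuous_pi fun p => (hc _).nndist (hc _)

theorem seqMat_eq_distMat {α : Type*} [MetricSpace α] (ρ : α) (x : ℕ → α) (m : ℕ)
    (p : {p : ℕ × ℕ // p.1 < p.2}) (h : p.1.2 < m + 1) :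
    seqMat ρ x p = distMat ρ m (fun i => x i)
      ⟨(⟨p.1.1, p.2.trans h⟩, ⟨p.1.2, h⟩), p.2⟩ := by
  have hc : ∀ i : Fin (m + 1), (Fin.cons ρ (fun i : Fin m => x i) : Fin (m + 1) → α) i =
      rootCons ρ x i := Fin.cases rfl fun _ => rfl
  simp only [seqMat, distMat, hc]

theorem dist_rootCons_eq {α β : Type*} [MetricSpace α] [MetricSpace β] {ρ : α} {σ : β}
    {x : ℕ → α} {y : ℕ → β} (h : seqMat ρ x = seqMat σ y) (i j : ℕ) :
    dist (rootCons ρ x i) (rootCons ρ x j) = dist (rootCons σ y i) (rootCons σ y j) := by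
  have key : ∀ i j, i < j →
      dist (rootCons ρ x i) (rootCons ρ x j) = dist (rootCons σ y i) (rootCons σ y j) :=
    fun i j hij => congrArg NNReal.toReal (congrFun h ⟨(i, j), hij⟩)
  rcases lt_trichotomy i j with h | rfl | h
  · exact key i j h
  · simp
  · rw [dist_comm, key j i h, dist_comm]

theorem map_infinitePi_fin {γ : Type*} [MeasurableSpace γ] (r : Measure γ) [IsProbabilityMeasure r]
    (m : ℕ) : (Measure.infinitePi fun _ : ℕ => r).map (fun x (i : Fin m) => x i) =
      Measure.pi fun _ : Fin m => r := by
  rw [← Measure.infinitePi_eq_pi]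
  exact Measure.map_infinitePi_infinitePi_of_inj (P := fun _ : ℕ => r) Fin.val_injective

/-- The empirical measure of the first `n + 1` points of a sequence. -/
noncomputable def empirical {α : Type*} [MeasurableSpace α] (x : ℕ → α) (n : ℕ) :
    ProbabilityMeasure α :=
  ⟨((n + 1 : ℕ) : ℝ≥0∞)⁻¹ • ∑ i ∈ Finset.range (n + 1), Measure.dirac (x i), ⟨by
    rw [Measure.smul_apply, Measure.finsetSum_apply]
    simp only [measure_univ, Finset.sum_const, Finset.card_range, nsmul_eq_mul, mul_one,
      smul_eq_mul]
    exact ENNReal.inv_mul_cancel (by simp) (by finiteness)⟩⟩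

theorem empirical_apply {α : Type*} [MeasurableSpace α] (x : ℕ → α) (n : ℕ) {U : Set α}
    (hU : MeasurableSet U) :
    (empirical x n : Measure α) U = ENNReal.ofReal
      ((∑ i ∈ Finset.range (n + 1), U.indicator 1 (x i)) / (n + 1 : ℕ)) := by
  change (((n + 1 : ℕ) : ℝ≥0∞)⁻¹ • ∑ i ∈ Finset.range (n + 1), Measure.dirac (x i)) U = _
  rw [Measure.smul_apply, Measure.finsetSum_apply, ENNReal.ofReal_div_of_pos (by positivity),
    ENNReal.ofReal_sum_of_nonneg fun i _ => Set.indicator_nonneg (f := (1 : α → ℝ))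
      (fun _ _ => zero_le_one) _,
    smul_eq_mul, mul_comm, ENNReal.ofReal_natCast, ENNReal.div_eq_inv_mul, mul_comm]
  congr 1
  refine Finset.sum_congr rfl fun i _ => ?_
  rw [Measure.dirac_apply' _ hU]
  by_cases h : x i ∈ U <;> simp [h]

/-- The strong law of large numbers for the indicators of `U` at the sample points. -/
theorem ae_tendsto_empirical_apply {α : Type*} [MeasurableSpace α] (p : Measure α) [IsProbabilityMeasure p] {U : Set α}
    (hU : MeasurableSet U) :
    ∀ᵐ x ∂(Measure.infinitePi fun _ : ℕ => p),
      Tendsto (fun n => (empirical x n : Measure α) U) atTop (𝓝 (p U)) := by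
  have hm : Measurable (U.indicator (1 : α → ℝ)) := measurable_one.indicator hU
  have hmi : ∀ i, Measurable fun x : ℕ → α => U.indicator (1 : α → ℝ) (x i) := fun i =>
    hm.comp (measurable_pi_apply i)
  have hlaw : ∀ i, Measure.map (fun x : ℕ → α => U.indicator (1 : α → ℝ) (x i))
      (Measure.infinitePi fun _ : ℕ => p) = p.map (U.indicator 1) := fun i => by
    have := Measure.infinitePi_map_eval (fun _ : ℕ => p) i
    conv_rhs => rw [← this, Measure.map_map hm (measurable_pi_apply i)]
    rfl
  have h := ProbabilityTheory.strong_law_ae_real (μ := Measure.infinitePi fun _ : ℕ => p)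
    (fun i x => U.indicator (1 : α → ℝ) (x i))
    (Integrable.of_bound (hmi 0).aestronglyMeasurable 1 (Eventually.of_forall fun x => by
      by_cases hx : x 0 ∈ U <;> simp [hx]))
    (fun i j hij => (ProbabilityTheory.iIndepFun_infinitePi (P := fun _ : ℕ => p)
      (X := fun _ => U.indicator (1 : α → ℝ)) (fun _ => hm)).indepFun hij)
    (fun i => ⟨(hmi i).aemeasurable, (hmi 0).aemeasurable, by rw [hlaw, hlaw]⟩)
  have hmean : ∫ x, U.indicator (1 : α → ℝ) (x 0) ∂(Measure.infinitePi fun _ : ℕ => p) =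
      p.real U := by
    have e := integral_map (μ := Measure.infinitePi fun _ : ℕ => p) (hmi 0).aemeasurable
      (f := fun t : ℝ => t) (by fun_prop)
    rw [hlaw, integral_map hm.aemeasurable (by fun_prop)] at e
    rw [← e, integral_indicator_one hU]
  filter_upwards [h] with x hx
  rw [hmean] at hx
  have h2 := (ENNReal.continuous_ofReal.tendsto _).comp (hx.comp (tendsto_add_atTop_nat 1))
  rw [ofReal_measureReal] at h2
  exact h2.congr fun n => (empirical_apply x n hU).symm

variable {α β : Type*} [MetricSpace α] [MeasurableSpace α] [BorelSpace α] [MetricSpace β]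
  [MeasurableSpace β] [BorelSpace β]

theorem empirical_map {φ : α → β} (hφ : Continuous φ) (x : ℕ → α) (n : ℕ) :
    (empirical x n).map (hφ.measurable.aemeasurable) = empirical (fun i => φ (x i)) n := by
  refine Subtype.ext (Measure.ext fun s hs => ?_)
  refine (Measure.map_apply hφ.measurable hs).trans ?_
  refine (empirical_apply x n (hφ.measurable hs)).trans ((empirical_apply _ n hs).trans ?_).symm
  rfl

/-- A sequence with weakly convergent empirical measures visits all open sets of positive mass. -/
theorem exists_mem_of_tendsto_empirical {p : ProbabilityMeasure α} {x : ℕ → α}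
    (h : Tendsto (empirical x) atTop (𝓝 p)) {U : Set α} (hU : IsOpen U)
    (hp : 0 < (p : Measure α) U) : ∃ i, x i ∈ U := by
  by_contra hne
  push Not at hne
  have := ProbabilityMeasure.le_liminf_measure_open_of_tendsto h hU
  have e : ∀ n, (empirical x n : Measure α) U = 0 := fun n => by
    rw [empirical_apply x n hU.measurableSet]
    simp [hne]
  simp only [e, liminf_const] at this
  exact (hp.trans_le this).ne rfl

variable [TopologicalSpace.SeparableSpace α] [TopologicalSpace.SeparableSpace β]

/-- The law of the infinite distance matrix is determined by its finite submatrices. -/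
theorem map_seqMat_eq {ρ : α} {σ : β} {p : Measure α} {q : Measure β} [IsProbabilityMeasure p]
    [IsProbabilityMeasure q]
    (h : ∀ m, (Measure.pi fun _ : Fin m => p).map (distMat ρ m) =
      (Measure.pi fun _ : Fin m => q).map (distMat σ m)) :
    (Measure.infinitePi fun _ : ℕ => p).map (seqMat ρ) =
      (Measure.infinitePi fun _ : ℕ => q).map (seqMat σ) := by
  have main : ∀ (I : Finset {p : ℕ × ℕ // p.1 < p.2}), ∃ (m : ℕ)
      (G : (PointedMMSpace.PairIndex m → ℝ≥0) → (I → ℝ≥0)), Measurable G ∧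
      (∀ x : ℕ → α, I.restrict (seqMat ρ x) = G (distMat ρ m fun i => x i)) ∧
      ∀ y : ℕ → β, I.restrict (seqMat σ y) = G (distMat σ m fun i => y i) := by
    intro I
    have hm : ∀ p ∈ I, p.1.2 < (I.sup fun p => p.1.2) + 1 := fun p hp =>
      Nat.lt_succ_of_le (Finset.le_sup (f := fun p : {p : ℕ × ℕ // p.1 < p.2} => p.1.2) hp)
    refine ⟨I.sup fun p => p.1.2, fun D p => D ⟨(⟨p.1.1.1, p.1.2.trans (hm _ p.2)⟩,
      ⟨p.1.1.2, hm _ p.2⟩), p.1.2⟩, by fun_prop, fun x => funext fun p => ?_,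
      fun x => funext fun p => ?_⟩
    · exact seqMat_eq_distMat ρ x _ p.1 (hm _ p.2)
    · exact seqMat_eq_distMat σ x _ p.1 (hm _ p.2)
  let P : ∀ I : Finset {p : ℕ × ℕ // p.1 < p.2}, Measure (I → ℝ≥0) := fun I =>
    ((Measure.infinitePi fun _ : ℕ => p).map (seqMat ρ)).map I.restrict
  have mρ := (continuous_seqMat ρ).measurable
  have mσ := (continuous_seqMat σ).measurable
  have : ∀ I, IsFiniteMeasure (P I) := fun I => by
    have := Measure.isFiniteMeasure_map ((Measure.infinitePi fun _ : ℕ => p)) (seqMat ρ)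
    exact Measure.isFiniteMeasure_map _ _
  refine IsProjectiveLimit.unique (P := P) (fun I => rfl) fun I => ?_
  obtain ⟨m, G, hG, h1, h2⟩ := main I
  have k1 : I.restrict ∘ seqMat ρ = G ∘ distMat ρ m ∘ fun x i => x i.val := funext h1
  have k2 : I.restrict ∘ seqMat σ = G ∘ distMat σ m ∘ fun x i => x i.val := funext h2
  have hr : Measurable (I.restrict : ({p : ℕ × ℕ // p.1 < p.2} → ℝ≥0) → _) :=
    Finset.measurable_restrict I
  have d1 : Measurable (distMat ρ m) := (continuous_distMat ρ m).measurable
  have d2 : Measurable (distMat σ m) := (continuous_distMat σ m).measurable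
  simp only [P]
  rw [Measure.map_map hr mσ, Measure.map_map hr mρ, k1, k2, ← Measure.map_map hG (by fun_prop),
    ← Measure.map_map hG (by fun_prop), ← Measure.map_map d1 (by fun_prop),
    ← Measure.map_map d2 (by fun_prop), map_infinitePi_fin, map_infinitePi_fin, h m]

/-- The empirical measures converge weakly almost surely. -/
theorem ae_tendsto_empirical (p : Measure α) [IsProbabilityMeasure p] :
    ∀ᵐ x ∂(Measure.infinitePi fun _ : ℕ => p),
      Tendsto (empirical x) atTop (𝓝 (⟨p, inferInstance⟩ : ProbabilityMeasure α)) := by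
  have := UniformSpace.secondCountable_of_separable α
  let b := TopologicalSpace.countableBasis α
  have hb : b.Countable := TopologicalSpace.countable_countableBasis α
  -- Finite intersections of basic open sets form a countable π-system that determines weak
  -- convergence, so one null set suffices.
  have hc : {F : Set (Set α) | F.Finite ∧ F ⊆ b}.Countable :=
    Set.countable_ofPred_finite_subset hb
  have hopen : ∀ F : Set (Set α), F.Finite ∧ F ⊆ b → IsOpen (⋂₀ F) := fun F hF =>
    hF.1.isOpen_sInter fun s hs => TopologicalSpace.isOpen_of_mem_countableBasis (hF.2 hs)
  have hpi : IsPiSystem ((⋂₀ ·) '' {F : Set (Set α) | F.Finite ∧ F ⊆ b}) := by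
    rintro _ ⟨F, hF, rfl⟩ _ ⟨G, hG, rfl⟩ -
    exact ⟨F ∪ G, ⟨hF.1.union hG.1, Set.union_subset hF.2 hG.2⟩, Set.sInter_union F G⟩
  filter_upwards [(ae_ball_iff hc).2 fun F hF =>
    ae_tendsto_empirical_apply p (hopen F hF).measurableSet] with x hx
  refine hpi.tendsto_probabilityMeasure_of_tendsto_of_mem ?_ ?_ ?_
  · rintro _ ⟨F, hF, rfl⟩
    exact (hopen F hF).measurableSet
  · intro u hu y hy
    obtain ⟨s, hs, hys, hsu⟩ :=
      (TopologicalSpace.isBasis_countableBasis α).exists_subset_of_mem_open hy hu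
    exact ⟨s, ⟨{s}, ⟨Set.finite_singleton s, by simpa using hs⟩, Set.sInter_singleton s⟩,
      (TopologicalSpace.isOpen_of_mem_countableBasis hs).mem_nhds hys, hsu⟩
  · rintro _ ⟨F, hF, rfl⟩
    exact (ENNReal.tendsto_toNNReal (measure_ne_top p _)).comp (hx F hF)

variable [CompleteSpace α] [CompleteSpace β]

/-- Almost sure events for sequences of samples have members with equal distance matrices. -/
theorem exists_seqMat_eq {ρ : α} {σ : β} {p : Measure α} {q : Measure β} [IsProbabilityMeasure p]
    [IsProbabilityMeasure q]
    (h : ∀ m, (Measure.pi fun _ : Fin m => p).map (distMat ρ m) =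
      (Measure.pi fun _ : Fin m => q).map (distMat σ m))
    {A : (ℕ → α) → Prop} {B : (ℕ → β) → Prop}
    (hA : ∀ᵐ x ∂(Measure.infinitePi fun _ : ℕ => p), A x)
    (hB : ∀ᵐ y ∂(Measure.infinitePi fun _ : ℕ => q), B y) :
    ∃ x y, A x ∧ B y ∧ seqMat ρ x = seqMat σ y := by
  have := UniformSpace.secondCountable_of_separable α
  have := UniformSpace.secondCountable_of_separable β
  have mρ := (continuous_seqMat ρ).measurable
  have mσ := (continuous_seqMat σ).measurable
  obtain ⟨s, hsA, hs, hs0⟩ := exists_measurable_superset_of_null (mem_ae_iff.1 hA)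
  obtain ⟨t, htB, ht, ht0⟩ := exists_measurable_superset_of_null (mem_ae_iff.1 hB)
  -- Otherwise two sets of full measure have disjoint images. These are analytic, so a Borel set
  -- separates them; it has mass one for one law and zero for the other, although the laws agree.
  by_contra hne
  have hdisj : Disjoint (seqMat ρ '' sᶜ) (seqMat σ '' tᶜ) := by
    rw [Set.disjoint_left]
    rintro _ ⟨x, hx, rfl⟩ ⟨y, hy, hxy⟩
    exact hne ⟨x, y, by_contra fun h => hx (hsA h), by_contra fun h => hy (htB h), hxy.symm⟩
  obtain ⟨u, hu1, hu2, hu⟩ := (hs.compl.analyticSet_image mρ).measurablySeparable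
    (ht.compl.analyticSet_image mσ) hdisj
  have e1 : (Measure.infinitePi fun _ : ℕ => p).map (seqMat ρ) u = 1 := by
    rw [Measure.map_apply mρ hu, ← prob_compl_eq_zero_iff (mρ hu)]
    refine measure_mono_null (fun x hx => ?_) hs0
    by_contra hxs
    exact hx (hu1 ⟨x, hxs, rfl⟩)
  have e2 : (Measure.infinitePi fun _ : ℕ => q).map (seqMat σ) u = 0 := by
    rw [Measure.map_apply mσ hu]
    refine measure_mono_null (fun y hy => ?_) ht0
    by_contra hyt
    exact Set.disjoint_left.1 hu2 ⟨y, hyt, rfl⟩ hy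
  rw [map_seqMat_eq h, e2] at e1
  exact zero_ne_one e1

end Sampling

/-! ### Reconstruction of a space from its functionals. -/

section Reconstruction

open scoped ENNReal BoundedContinuousFunction

theorem withDensity_map_eq {α β : Type*} [MeasurableSpace α] [MeasurableSpace β] {φ : α → β}
    (hφ : Measurable φ) (μ : Measure α) {g : β → ℝ≥0∞} (hg : Measurable g) :
    (μ.map φ).withDensity g = (μ.withDensity (g ∘ φ)).map φ := by
  ext s hs
  rw [Measure.map_apply hφ hs, withDensity_apply _ hs, withDensity_apply _ (hφ hs),
    setLIntegral_map hs hg hφ]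
  rfl

/-- There is a positive continuous weight which is integrable, as a function of the distance to the
root, for all measures with given bounds on the masses of their cut-offs. -/
theorem exists_weight (a : ℕ → ℝ≥0) : ∃ w : ℝ≥0 → ℝ≥0, Continuous w ∧ (∀ t, 0 < w t) ∧
    ∀ {α : Type} [MetricSpace α] [MeasurableSpace α] [BorelSpace α] (ρ : α) (μ : Measure α),
      (∀ k, rootCut ρ μ k Set.univ ≤ a k) → ∫⁻ x, w (nndist ρ x) ∂μ ≤ 1 := by
  -- The factor `(1 + a k)⁻¹` gives `c k * a k ≤ 2 ^ (-k - 1)`, so the integrals sum to at most one;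
  -- it also keeps the series uniformly convergent, hence continuous.
  let c : ℕ → ℝ≥0 := fun k => (1 / 2) * (1 / 2) ^ k / (1 + a k)
  have hc : ∀ k, 0 < c k := fun k => by positivity
  have hcle : ∀ k t, c k * cutoff k t ≤ (1 / 2) * (1 / 2) ^ k := fun k t =>
    (mul_le_of_le_one_right' (cutoff_le_one k t)).trans (div_le_self (by positivity) (by simp))
  have hsum2 : HasSum (fun k : ℕ => (1 / 2 : ℝ≥0) * (1 / 2) ^ k) 1 := by
    rw [← NNReal.hasSum_coe]
    have := hasSum_geometric_two.mul_left (1 / 2 : ℝ)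
    norm_num at this ⊢
    exact this
  have hsum : ∀ t, Summable fun k => c k * cutoff k t := fun t =>
    NNReal.summable_of_le (hcle · t) hsum2.summable
  refine ⟨fun t => ∑' k, c k * cutoff k t, ?_, fun t => ?_, ?_⟩
  · have h : Continuous fun t : ℝ≥0 => ∑' k, ((c k * cutoff k t : ℝ≥0) : ℝ) := by
      refine continuous_tsum (fun k => by fun_prop) (NNReal.summable_coe.2 hsum2.summable)
        fun k t => ?_
      rw [NNReal.norm_eq]
      exact NNReal.coe_le_coe.2 (hcle k t)
    simp_rw [← NNReal.coe_tsum] at h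
    exact (NNReal.isEmbedding_coe.continuous_iff).2 h
  · obtain ⟨k, hk⟩ := exists_nat_ge t
    have : 0 < c k * cutoff k t := by
      rw [cutoff_eq_one hk, mul_one]; exact hc k
    exact this.trans_le ((hsum t).le_tsum k fun _ _ => zero_le)
  · intro α _ _ _ ρ μ hμ
    simp_rw [ENNReal.coe_tsum (hsum _)]
    rw [lintegral_tsum fun k => by fun_prop]
    have h1 : ∀ k, ∫⁻ x, ((c k * cutoff k (nndist ρ x) : ℝ≥0) : ℝ≥0∞) ∂μ ≤
        (((1 / 2) * (1 / 2) ^ k : ℝ≥0) : ℝ≥0∞) := fun k => by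
      simp_rw [ENNReal.coe_mul (c k)]
      rw [lintegral_const_mul _ (by fun_prop)]
      have := hμ k
      rw [rootCut, withDensity_apply _ MeasurableSet.univ, Measure.restrict_univ] at this
      calc (c k : ℝ≥0∞) * ∫⁻ x, (cutoff k (nndist ρ x) : ℝ≥0∞) ∂μ ≤ c k * a k := by gcongr
        _ = ((c k * a k : ℝ≥0) : ℝ≥0∞) := by push_cast; rfl
        _ ≤ _ := by
          rw [ENNReal.coe_le_coe]
          rw [div_mul_eq_mul_div]
          exact div_le_of_le_mul₀ zero_le zero_le (by gcongr; simp)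
    refine (ENNReal.tsum_le_tsum h1).trans ?_
    rw [← ENNReal.coe_tsum hsum2.summable, hsum2.tsum_eq]
    simp

variable {α β : Type*} [MetricSpace α] [TopologicalSpace.SeparableSpace α]
  [MeasurableSpace α] [BorelSpace α] [MetricSpace β]
  [TopologicalSpace.SeparableSpace β] [MeasurableSpace β] [BorelSpace β]

/-- The integrals of the distance matrix for a measure with a continuous density are limits of
functionals. -/
theorem tendsto_distFunctional_weight {ρ : α} {μ : Measure α} [IsBoundedlyFinite μ]
    {w : ℝ≥0 → ℝ≥0} (hw : Continuous w)
    [IsFiniteMeasure (μ.withDensity fun x => (w (nndist ρ x) : ℝ≥0∞))] {m : ℕ}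
    (g : (PointedMMSpace.PairIndex m → ℝ≥0) →ᵇ ℝ) :
    Tendsto (fun k => distFunctional ρ μ m k
      ⟨fun D => ((∏ i : Fin m, w (D (rootIndex i)) : ℝ≥0) : ℝ) * g D, by fun_prop⟩) atTop
      (𝓝 (∫ D, g D ∂((Measure.pi fun _ : Fin m =>
        μ.withDensity fun x => (w (nndist ρ x) : ℝ≥0∞)).map (distMat ρ m)))) := by
  have e : ∀ k, distFunctional ρ μ m k
      ⟨fun D => ((∏ i : Fin m, w (D (rootIndex i)) : ℝ≥0) : ℝ) * g D, by fun_prop⟩ =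
      ∫ x, ((∏ i, cutoff k (nndist ρ (x i)) : ℝ≥0) : ℝ) * g (distMat ρ m x)
        ∂(Measure.pi fun _ : Fin m => μ.withDensity fun x => (w (nndist ρ x) : ℝ≥0∞)) := fun k => by
    rw [distFunctional_eq_integral_pi, pi_withDensity _ _ (by fun_prop),
      integral_withDensity_eq_integral_smul (by fun_prop)]
    refine integral_congr_ae (Eventually.of_forall fun x => ?_)
    simp only [ContinuousMap.coe_mk, distMat_rootIndex, NNReal.smul_def, smul_eq_mul]
    ring
  simp_rw [e]
  rw [integral_map (by fun_prop) g.continuous.aestronglyMeasurable]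
  refine tendsto_integral_of_dominated_convergence (fun _ => ‖g‖) (fun k => ?_)
    (integrable_const _) (fun k => Eventually.of_forall fun x => ?_)
    (Eventually.of_forall fun x => ?_)
  · refine Continuous.aestronglyMeasurable ?_
    have := continuous_distMat ρ m
    fun_prop
  · rw [norm_mul, NNReal.norm_eq]
    refine (mul_le_of_le_one_left (norm_nonneg _) ?_).trans (g.norm_coe_le_norm _)
    exact_mod_cast Finset.prod_le_one' fun i _ => cutoff_le_one k _
  · refine tendsto_const_nhds.congr' ?_
    have : ∀ᶠ k : ℕ in atTop, ∀ i, nndist ρ (x i) ≤ k :=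
      eventually_all.2 fun i => by
        obtain ⟨N, hN⟩ := exists_nat_ge (nndist ρ (x i))
        exact (eventually_ge_atTop N).mono fun k hk => hN.trans (by exact_mod_cast hk)
    filter_upwards [this] with k hk
    simp [fun i => cutoff_eq_one (hk i)]

/-- The product of the weights depends only on the root row, so it can be absorbed into the test
function; letting the cut-off tend to one removes it. -/
theorem map_distMat_weight_eq {ρ : α} {σ : β} {μ : Measure α} {ν : Measure β}
    [IsBoundedlyFinite μ] [IsBoundedlyFinite ν]
    (h : ∀ m k f, distFunctional ρ μ m k f = distFunctional σ ν m k f)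
    {w : ℝ≥0 → ℝ≥0} (hw : Continuous w)
    [IsFiniteMeasure (μ.withDensity fun x => (w (nndist ρ x) : ℝ≥0∞))]
    [IsFiniteMeasure (ν.withDensity fun x => (w (nndist σ x) : ℝ≥0∞))] (m : ℕ) :
    (Measure.pi fun _ : Fin m => μ.withDensity fun x => (w (nndist ρ x) : ℝ≥0∞)).map (distMat ρ m) =
      (Measure.pi fun _ : Fin m =>
        ν.withDensity fun x => (w (nndist σ x) : ℝ≥0∞)).map (distMat σ m) := by
  refine ext_of_forall_integral_eq_of_IsFiniteMeasure fun g => ?_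
  refine tendsto_nhds_unique (tendsto_distFunctional_weight hw g) ?_
  simp_rw [h]
  exact tendsto_distFunctional_weight hw g

theorem distFunctional_one_one (ρ : α) (μ : Measure α) [IsBoundedlyFinite μ] (k : ℕ) :
    distFunctional ρ μ 1 k 1 = (rootCut ρ μ k).real Set.univ := by
  rw [distFunctional_eq]
  simp [measureReal_def, Measure.pi_univ]

/-- Two typical samples with the same distance matrix are dense once the root is added, so they
extend to an isometry. It carries empirical measures to empirical measures, hence `p` to `q` in the
limit. -/
theorem exists_isometryEquiv_of_law_eq [CompleteSpace α] [CompleteSpace β] {ρ : α} {σ : β}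
    {p : Measure α} {q : Measure β} [IsProbabilityMeasure p] [IsProbabilityMeasure q]
    (h : ∀ m, (Measure.pi fun _ : Fin m => p).map (distMat ρ m) =
      (Measure.pi fun _ : Fin m => q).map (distMat σ m))
    (hp : ∀ U : Set α, IsOpen U → U.Nonempty → ρ ∉ U → 0 < p U)
    (hq : ∀ U : Set β, IsOpen U → U.Nonempty → σ ∉ U → 0 < q U) :
    ∃ φ : α ≃ᵢ β, φ ρ = σ ∧ p.map φ = q := by
  have := UniformSpace.secondCountable_of_separable α
  have := UniformSpace.secondCountable_of_separable β
  obtain ⟨x, y, hx, hy, hxy⟩ := exists_seqMat_eq h (ae_tendsto_empirical p) (ae_tendsto_empirical q)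
  have hdx : DenseRange (rootCons ρ x) := by
    rw [DenseRange, dense_iff_inter_open]
    intro U hU hne
    by_cases hρ : ρ ∈ U
    · exact ⟨ρ, hρ, 0, rfl⟩
    · obtain ⟨i, hi⟩ := exists_mem_of_tendsto_empirical hx hU (hp U hU hne hρ)
      exact ⟨x i, hi, i + 1, rfl⟩
  have hdy : DenseRange (rootCons σ y) := by
    rw [DenseRange, dense_iff_inter_open]
    intro U hU hne
    by_cases hσ : σ ∈ U
    · exact ⟨σ, hσ, 0, rfl⟩
    · obtain ⟨i, hi⟩ := exists_mem_of_tendsto_empirical hy hU (hq U hU hne hσ)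
      exact ⟨y i, hi, i + 1, rfl⟩
  obtain ⟨φ, hφ⟩ := exists_isometryEquiv_of_denseRange hdx hdy (dist_rootCons_eq hxy)
  refine ⟨φ, hφ 0, ?_⟩
  have h1 := ProbabilityMeasure.tendsto_map_of_tendsto_of_continuous _ _ hx φ.continuous
  have e : ∀ n, (empirical x n).map φ.continuous.measurable.aemeasurable = empirical y n :=
    fun n => by rw [empirical_map φ.continuous]; exact congrArg (empirical · n) (funext fun i => hφ (i + 1))
  simp_rw [e] at h1
  exact congrArg (fun r : ProbabilityMeasure β => (r : Measure β)) (tendsto_nhds_unique h1 hy)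

end Reconstruction

section

variable {α β : Type} [MetricSpace α] [TopologicalSpace.SeparableSpace α]
  [MeasurableSpace α] [BorelSpace α] [MetricSpace β]
  [TopologicalSpace.SeparableSpace β] [MeasurableSpace β] [BorelSpace β]

open scoped ENNReal

/-- Infinite measures cannot be sampled, so both are multiplied by the same positive function of the
distance to the root. A root preserving isometry respects this density, which can then be divided
out. -/
theorem exists_isometryEquiv_of_distFunctional_eq [CompleteSpace α] [CompleteSpace β] {ρ : α} {σ : β}
    {μ : Measure α} {ν : Measure β} [IsBoundedlyFinite μ] [IsBoundedlyFinite ν]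
    (h : ∀ m k f, distFunctional ρ μ m k f = distFunctional σ ν m k f)
    (hμ : ∀ U : Set α, IsOpen U → U.Nonempty → ρ ∉ U → 0 < μ U)
    (hν : ∀ U : Set β, IsOpen U → U.Nonempty → σ ∉ U → 0 < ν U) :
    ∃ φ : α ≃ᵢ β, φ ρ = σ ∧ μ.map φ = ν := by
  have hmass : ∀ k, rootCut ρ μ k Set.univ = rootCut σ ν k Set.univ := fun k => by
    have := h 1 k 1
    rw [distFunctional_one_one, distFunctional_one_one] at this
    exact (measureReal_eq_measureReal_iff).1 this
  obtain ⟨w, hw, hpos, hint⟩ := exists_weight fun k => (rootCut ρ μ k Set.univ).toNNReal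
  have hca : ∀ k, ((rootCut ρ μ k Set.univ).toNNReal : ℝ≥0∞) = rootCut ρ μ k Set.univ := fun k =>
    ENNReal.coe_toNNReal (measure_ne_top _ _)
  have iμ := hint ρ μ fun k => (hca k).ge
  have iν := hint σ ν fun k => by rw [hca k, hmass k]
  have : IsFiniteMeasure (μ.withDensity fun x => (w (nndist ρ x) : ℝ≥0∞)) :=
    isFiniteMeasure_withDensity (iμ.trans_lt ENNReal.one_lt_top).ne
  have : IsFiniteMeasure (ν.withDensity fun x => (w (nndist σ x) : ℝ≥0∞)) :=
    isFiniteMeasure_withDensity (iν.trans_lt ENNReal.one_lt_top).ne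
  have hcc : (μ.withDensity fun x => (w (nndist ρ x) : ℝ≥0∞)) Set.univ =
      (ν.withDensity fun x => (w (nndist σ x) : ℝ≥0∞)) Set.univ := by
    have := congrArg (· Set.univ) (map_distMat_weight_eq h hw 1)
    beta_reduce at this
    rw [Measure.map_apply (by fun_prop) MeasurableSet.univ,
      Measure.map_apply (by fun_prop) MeasurableSet.univ, Set.preimage_univ, Set.preimage_univ,
      Measure.pi_univ, Measure.pi_univ] at this
    simpa using this
  simp only [withDensity_apply _ MeasurableSet.univ, Measure.restrict_univ] at hcc
  obtain ⟨c, hc⟩ : ∃ c : ℝ≥0, ∫⁻ x, w (nndist ρ x) ∂μ = c :=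
    ⟨_, (ENNReal.coe_toNNReal (iμ.trans_lt ENNReal.one_lt_top).ne).symm⟩
  have hc' : ∫⁻ x, w (nndist σ x) ∂ν = c := hcc.symm.trans hc
  -- A zero mass cannot be normalised, but then the measures vanish and both spaces consist of the
  -- root, since open sets missing the root have positive mass.
  rcases eq_or_ne c 0 with rfl | hc0
  · have hz : ∀ {γ : Type} [MetricSpace γ] [MeasurableSpace γ] [BorelSpace γ] (τ : γ) (κ : Measure γ),
        ∫⁻ x, w (nndist τ x) ∂κ = (0 : ℝ≥0) →
        (∀ U : Set γ, IsOpen U → U.Nonempty → τ ∉ U → 0 < κ U) → κ = 0 ∧ ∀ x, x = τ := by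
      intro γ _ _ _ τ κ hi hU
      rw [ENNReal.coe_zero, lintegral_eq_zero_iff (by fun_prop)] at hi
      have h0 : κ = 0 := by
        rw [← ae_eq_bot, ← empty_mem_iff_bot]
        exact hi.mono fun x hx => absurd hx (by simpa using (hpos _).ne')
      refine ⟨h0, fun x => by_contra fun hx => ?_⟩
      have := hU {τ}ᶜ isOpen_compl_singleton ⟨x, hx⟩ (by simp)
      simp [h0] at this
    obtain ⟨rfl, h1⟩ := hz ρ μ hc hμ
    obtain ⟨rfl, h2⟩ := hz σ ν hc' hν
    refine ⟨⟨⟨fun _ => σ, fun _ => ρ, fun x => (h1 x).symm, fun x => (h2 x).symm⟩,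
      Isometry.of_dist_eq fun x y => ?_⟩, rfl, Measure.map_zero _⟩
    rw [h1 x, h1 y, dist_self, dist_self]
  · let w' : ℝ≥0 → ℝ≥0 := fun t => c⁻¹ * w t
    have hw' : Continuous w' := by fun_prop
    have hpos' : ∀ t, 0 < w' t := fun t => mul_pos (inv_pos.2 (pos_iff_ne_zero.2 hc0)) (hpos t)
    have hprob : ∀ {γ : Type} [MetricSpace γ] [MeasurableSpace γ] [BorelSpace γ] (τ : γ)
        (κ : Measure γ), ∫⁻ x, w (nndist τ x) ∂κ = c →
        IsProbabilityMeasure (κ.withDensity fun x => (w' (nndist τ x) : ℝ≥0∞)) := by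
      intro γ _ _ _ τ κ hi
      refine ⟨?_⟩
      rw [withDensity_apply _ MeasurableSet.univ, Measure.restrict_univ]
      simp only [w', ENNReal.coe_mul]
      rw [lintegral_const_mul _ (by fun_prop), hi, ← ENNReal.coe_mul, inv_mul_cancel₀ hc0,
        ENNReal.coe_one]
    have := hprob ρ μ hc
    have := hprob σ ν hc'
    have hopen : ∀ {γ : Type} [MetricSpace γ] [MeasurableSpace γ] [BorelSpace γ] (τ : γ)
        (κ : Measure γ) (U : Set γ), 0 < κ U →
        0 < (κ.withDensity fun x => (w' (nndist τ x) : ℝ≥0∞)) U := by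
      intro γ _ _ _ τ κ U hU
      refine pos_iff_ne_zero.2 fun h0 => hU.ne' ?_
      refine withDensity_absolutelyContinuous' (by fun_prop) (Eventually.of_forall fun x => ?_) h0
      simpa using (hpos' _).ne'
    obtain ⟨φ, hφ, hm⟩ := exists_isometryEquiv_of_law_eq (ρ := ρ) (σ := σ)
      (map_distMat_weight_eq h hw') (fun U h1 h2 h3 => hopen ρ μ U (hμ U h1 h2 h3))
      (fun U h1 h2 h3 => hopen σ ν U (hν U h1 h2 h3))
    refine ⟨φ, hφ, ?_⟩
    have inv : ∀ {γ : Type} [MetricSpace γ] [MeasurableSpace γ] [BorelSpace γ] (τ : γ)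
        (κ : Measure γ), (κ.withDensity fun x => (w' (nndist τ x) : ℝ≥0∞)).withDensity
          (fun x => (w' (nndist τ x) : ℝ≥0∞)⁻¹) = κ := by
      intro γ _ _ _ τ κ
      exact withDensity_inv_same (by fun_prop)
        (Eventually.of_forall fun x => by simpa using (hpos' _).ne')
        (Eventually.of_forall fun x => ENNReal.coe_ne_top)
    rw [← inv σ ν, ← hm, withDensity_map_eq φ.continuous.measurable _ (by fun_prop)]
    have : ((fun x => (w' (nndist σ x) : ℝ≥0∞)⁻¹) ∘ φ) = fun x => (w' (nndist ρ x) : ℝ≥0∞)⁻¹ := by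
      funext x
      simp only [Function.comp, ← hφ, φ.isometry.nndist_eq]
    rw [this, inv ρ μ]

end

namespace PointedMMSpace

theorem coreSpace_pos (X : PointedMMSpace) (U : Set X.coreSpace.carrier) (hU : IsOpen U)
    (hne : U.Nonempty) (hρ : X.coreSpace.root ∉ U) : 0 < X.coreSpace.measure U := by
  obtain ⟨V, hV, rfl⟩ := isOpen_induced_iff.1 hU
  obtain ⟨⟨x, hx⟩, hxV⟩ := hne
  rcases hx with hx | hx
  · have h1 := (Measure.mem_support_iff_forall x).1 hx V (hV.mem_nhds hxV)
    rw [← X.coreMeasure_map_val, Measure.map_apply measurable_subtype_coe hV.measurableSet] at h1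
    exact h1
  · obtain rfl := Set.mem_singleton_iff.1 hx
    exact absurd hxV hρ

/-- The functionals determine the equivalence class. -/
theorem equivalent_of_functional_eq {X Y : PointedMMSpace}
    (h : ∀ m k f, X.functional m k f = Y.functional m k f) : Equivalent X Y :=
  exists_isometryEquiv_of_distFunctional_eq (α := X.coreSpace.carrier) (β := Y.coreSpace.carrier)
    (ρ := X.coreSpace.root) (σ := Y.coreSpace.root) (μ := X.coreSpace.measure)
    (ν := Y.coreSpace.measure)
    (fun m k f => (X.functional_coreSpace m k f).trans
      ((h m k f).trans (Y.functional_coreSpace m k f).symm)) X.coreSpace_pos Y.coreSpace_pos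

end PointedMMSpace

namespace MMSpace

theorem mk_eq_iff_coord {X Y : PointedMMSpace} : mk X = mk Y ↔ X.coord = Y.coord :=
  ⟨fun h => congrArg coord h, fun h => Quotient.sound
    (PointedMMSpace.equivalent_of_functional_eq (PointedMMSpace.functional_eq_of_coord_eq h))⟩

theorem isEmbedding_coord : IsEmbedding MMSpace.coord :=
  ⟨isInducing_coord, fun x y h => by
    obtain ⟨X, rfl⟩ := x.exists_mk
    obtain ⟨Y, rfl⟩ := y.exists_mk
    exact mk_eq_iff_coord.2 h⟩

end MMSpace

/-! ### Heine-Borel and compact classes in terms of vanishing functionals. -/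

section Separation

open scoped ENNReal

theorem rootCut_pos {α : Type*} [MetricSpace α] [MeasurableSpace α] [BorelSpace α] {ρ : α}
    {μ : Measure α} {k : ℕ} {x : α} (hx : x ∈ μ.support) (hk : nndist ρ x < k + 1) {U : Set α}
    (hU : U ∈ 𝓝 x) : 0 < rootCut ρ μ k U := by
  have hV : {y | nndist ρ y < k + 1} ∈ 𝓝 x :=
    (isOpen_lt (by fun_prop) continuous_const).mem_nhds hk
  refine pos_iff_ne_zero.2 fun h0 => ?_
  rw [rootCut, withDensity_apply_eq_zero' (by fun_prop)] at h0
  refine ((Measure.mem_support_iff_forall x).1 hx _ (inter_mem hV hU)).ne'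
    (measure_mono_null (Set.inter_subset_inter_left _ fun y hy => ?_) h0)
  simpa using (cutoff_pos hy).ne'

/-- A nonnegative continuous integrand that is positive at a tuple of support points is positive on
a product of neighbourhoods, which has positive mass. -/
theorem distFunctional_eq_zero_iff {α : Type*} [MetricSpace α] [MeasurableSpace α] [BorelSpace α]
    [TopologicalSpace.SeparableSpace α] {ρ : α} {μ : Measure α} [IsBoundedlyFinite μ] {m k : ℕ}
    {f : C(PointedMMSpace.PairIndex m → ℝ≥0, ℝ)} (hf : ∀ D, 0 ≤ f D) :
    distFunctional ρ μ m k f = 0 ↔ ∀ x : Fin m → α, (∀ i, x i ∈ μ.support) →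
      (∀ i, nndist ρ (x i) < k + 1) → f (distMat ρ m x) = 0 := by
  have := UniformSpace.secondCountable_of_separable α
  have hc := continuous_distMat ρ m
  have hint : Integrable (fun x => f (distMat ρ m x))
      (Measure.pi fun _ : Fin m => rootCut ρ μ k) :=
    (integrable_distLaw ρ μ m k f).comp_measurable hc.measurable
  rw [distFunctional_eq, integral_eq_zero_iff_of_nonneg (fun x => hf _) hint]
  constructor
  · intro h x hx hk
    by_contra hne
    have hpos : {y : Fin m → α | f (distMat ρ m y) ≠ 0} ∈ 𝓝 x :=
      (isOpen_ne_fun (by fun_prop) continuous_const).mem_nhds hne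
    rw [nhds_pi, Filter.mem_pi'] at hpos
    obtain ⟨I, U, hU, hIU⟩ := hpos
    have h0 : (Measure.pi fun _ : Fin m => rootCut ρ μ k) (Set.univ.pi U) = 0 :=
      measure_mono_null ((Set.pi_mono' (fun _ _ => subset_rfl) (Set.subset_univ _)).trans hIU)
        (ae_iff.1 h)
    rw [Measure.pi_pi, Finset.prod_eq_zero_iff] at h0
    obtain ⟨i, -, hi⟩ := h0
    exact (rootCut_pos (hx i) (hk i) (hU i)).ne' hi
  · intro h
    have hs : ∀ᵐ x ∂(rootCut ρ μ k), x ∈ μ.support :=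
      withDensity_absolutelyContinuous _ _ Measure.support_mem_ae
    have hs' : ∀ᵐ x ∂(Measure.pi fun _ : Fin m => rootCut ρ μ k), ∀ i, x i ∈ μ.support :=
      eventually_all.2 fun i => (Measure.tendsto_eval_ae_ae (μ := fun _ : Fin m => rootCut ρ μ k)
        (i := i)).eventually hs
    filter_upwards [hs', pi_rootCut_ae ρ μ m k] with x h1 h2 using h x h1 h2

end Separation

namespace PointedMMSpace

/-- A function which is positive if the points are at distance more than `1 / (k + 1)`. -/
noncomputable def sepFun (m k : ℕ) : C(PairIndex m → ℝ≥0, ℝ) where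
  toFun D := ∏ p : PairIndex m, if p.1.1 = 0 then 1 else max ((D p : ℝ) - 1 / (k + 1)) 0
  continuous_toFun := continuous_finsetProd _ fun p _ => by
    split_ifs <;> fun_prop

theorem sepFun_nonneg (m k : ℕ) (D) : 0 ≤ sepFun m k D :=
  Finset.prod_nonneg fun p _ => by split_ifs <;> simp

/-- A function which is positive if the point has distance more than `R` from the root. -/
noncomputable def farFun (R : ℝ) : C(PairIndex 1 → ℝ≥0, ℝ) where
  toFun D := max ((D (rootIndex 0) : ℝ) - R) 0
  continuous_toFun := by fun_prop

/-- Pairs containing the root contribute the factor `1`, so only distances among the sampled points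
count. -/
theorem sepFun_distMat_eq_zero_iff {α : Type*} [MetricSpace α] (ρ : α) {m k : ℕ} (x : Fin m → α) :
    sepFun m k (distMat ρ m x) = 0 ↔ ∃ i j, i < j ∧ dist (x i) (x j) ≤ 1 / (k + 1) := by
  change (∏ p : PairIndex m, if p.1.1 = 0 then (1 : ℝ) else _) = 0 ↔ _
  rw [Finset.prod_eq_zero_iff]
  constructor
  · rintro ⟨⟨⟨a, b⟩, hab⟩, -, h⟩
    simp only at h hab
    split_ifs at h with ha
    · exact absurd h one_ne_zero
    obtain ⟨i, rfl⟩ := Fin.exists_succ_eq.2 ha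
    obtain ⟨j, rfl⟩ := Fin.exists_succ_eq.2 (ne_of_gt (lt_of_le_of_lt (Fin.zero_le _) hab))
    refine ⟨i, j, Fin.succ_lt_succ_iff.1 hab, ?_⟩
    simpa [distMat] using h
  · rintro ⟨i, j, hij, h⟩
    refine ⟨⟨(i.succ, j.succ), Fin.succ_lt_succ_iff.2 hij⟩, Finset.mem_univ _, ?_⟩
    simpa [distMat, Fin.succ_ne_zero] using h

theorem functional_eq_zero_iff {X : PointedMMSpace} {m k : ℕ} {f : C(PairIndex m → ℝ≥0, ℝ)}
    (hf : ∀ D, 0 ≤ f D) : X.functional m k f = 0 ↔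
      ∀ x : Fin m → X.carrier, (∀ i, x i ∈ X.measure.support) →
        (∀ i, nndist X.root (x i) < k + 1) → f (distMat X.root m x) = 0 :=
  distFunctional_eq_zero_iff hf

/-- Among any `N` points of the support in the ball of radius `k + 1`, two have distance at most
`1 / (k + 1)`. -/
def SepBound (X : PointedMMSpace) (k N : ℕ) : Prop := X.functional N k (sepFun N k) = 0

theorem sepBound_iff {X : PointedMMSpace} {k N : ℕ} : X.SepBound k N ↔
    ∀ x : Fin N → X.carrier, (∀ i, x i ∈ X.measure.support) →
      (∀ i, nndist X.root (x i) < k + 1) → ∃ i j, i < j ∧ dist (x i) (x j) ≤ 1 / (k + 1) := by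
  rw [SepBound, functional_eq_zero_iff (sepFun_nonneg N k)]
  simp_rw [sepFun_distMat_eq_zero_iff]

theorem SepBound.mono {X : PointedMMSpace} {k N N' : ℕ} (h : X.SepBound k N) (hN : N ≤ N') :
    X.SepBound k N' := by
  rw [sepBound_iff] at h ⊢
  intro x hx hk
  obtain ⟨i, j, hij, hd⟩ := h (x ∘ Fin.castLE hN) (fun i => hx _) (fun i => hk _)
  exact ⟨_, _, (Fin.castLEOrderEmb hN).strictMono hij, hd⟩

/-- The support is contained in the closed ball of radius `R`. -/
def FarBound (X : PointedMMSpace) (R : ℝ) : Prop := ∀ k, X.functional 1 k (farFun R) = 0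

theorem farBound_iff {X : PointedMMSpace} {R : ℝ} :
    X.FarBound R ↔ ∀ x ∈ X.measure.support, dist X.root x ≤ R := by
  have h0 : ∀ D, 0 ≤ farFun R D := fun D => le_max_right _ _
  have h1 : ∀ x : Fin 1 → X.carrier, farFun R (distMat X.root 1 x) = 0 ↔ dist X.root (x 0) ≤ R := by
    intro x
    change max ((distMat X.root 1 x (rootIndex 0) : ℝ) - R) 0 = 0 ↔ _
    rw [distMat_rootIndex]
    simp
  simp only [FarBound, functional_eq_zero_iff h0, h1]
  constructor
  · intro h x hx
    obtain ⟨k, hk⟩ := exists_nat_ge (nndist X.root x)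
    exact h k (fun _ => x) (fun _ => hx) (fun _ => hk.trans_lt (lt_add_one _))
  · exact fun h k x hx _ => h _ (hx 0)

/-- A space with a separation bound has a finite net of the ball. -/
theorem SepBound.exists_net {X : PointedMMSpace} {k N : ℕ} (h : X.SepBound k N) :
    ∃ p : ℕ → X.carrier, p 0 = X.root ∧ (∀ i, p i ∈ X.core ∧ nndist X.root (p i) ≤ k + 1) ∧
      ∀ x ∈ X.core, nndist X.root x < k + 1 → ∃ i ≤ N, dist (p i) x ≤ 1 / (k + 1) := by
  classical
  have hex : ∃ N, X.SepBound k N := ⟨N, h⟩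
  -- For the least bound `n = n' + 1` there are `n'` separated points. No further support point of
  -- the ball can be added to them, so they form a net; the root is put in front as index `0`.
  set n := Nat.find hex with hn
  have hnN : n ≤ N := Nat.find_min' hex h
  have hfind := Nat.find_spec hex
  rw [← hn] at hfind
  obtain ⟨n', hn'⟩ : ∃ n', n = n' + 1 := by
    refine Nat.exists_eq_succ_of_ne_zero fun h0 => ?_
    rw [h0, sepBound_iff] at hfind
    obtain ⟨i, -⟩ := hfind finZeroElim finZeroElim finZeroElim
    exact i.elim0
  have hnot : ¬ X.SepBound k n' := Nat.find_min hex (by omega)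
  rw [sepBound_iff] at hnot
  push Not at hnot
  obtain ⟨y, hy, hyk, hyd⟩ := hnot
  rw [hn', sepBound_iff] at hfind
  refine ⟨fun i => Nat.casesOn i X.root fun i => if h : i < n' then y ⟨i, h⟩ else X.root, rfl, ?_, ?_⟩
  · rintro (_ | i)
    · simp [X.root_mem_core]
    · simp only
      split_ifs with hi
      · exact ⟨Or.inl (hy _), (hyk _).le⟩
      · simp [X.root_mem_core]
  · rintro x (hx | hx) hxk
    · by_contra hne
      push Not at hne
      obtain ⟨i, j, hij, hd⟩ := hfind (Fin.cons x y) (Fin.cases hx hy) (Fin.cases hxk hyk)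
      have hxy : ∀ i, 1 / (k + 1 : ℝ) < dist (y i) x := fun i => by
        have := hne (i + 1) (by omega)
        simpa using this
      induction i using Fin.cases with
      | zero =>
        obtain ⟨j, rfl⟩ := Fin.exists_succ_eq.2 hij.ne'
        rw [Fin.cons_zero, Fin.cons_succ, dist_comm] at hd
        exact (hxy j).not_ge hd
      | succ i =>
        obtain ⟨j, rfl⟩ := Fin.exists_succ_eq.2 (ne_of_gt (lt_of_le_of_lt (Fin.zero_le _) hij))
        rw [Fin.cons_succ, Fin.cons_succ] at hd
        exact (hyd i j (Fin.succ_lt_succ_iff.1 hij)).not_ge hd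
    · obtain rfl := Set.mem_singleton_iff.1 hx
      exact ⟨0, Nat.zero_le _, (dist_self X.root).trans_le (by positivity)⟩

/-- Pigeonhole: the compact ball is covered by finitely many balls of radius `1 / (2 * (k + 1))`,
and two points in one of them are close enough. -/
theorem exists_sepBound_of_properSpace (X : PointedMMSpace) [ProperSpace X.carrier] (k : ℕ) :
    ∃ N, X.SepBound k N := by
  obtain ⟨t, -, htf, ht⟩ := (isCompact_closedBall X.root (k + 1 : ℝ)).finite_cover_balls
    (e := 1 / (2 * (k + 1))) (by positivity)
  have : Fintype t := htf.fintype
  refine ⟨Fintype.card t + 1, sepBound_iff.2 fun x _ hk => ?_⟩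
  have hx : ∀ i, ∃ c : t, dist (x i) c < 1 / (2 * (k + 1)) := fun i => by
    have hi : x i ∈ Metric.closedBall X.root (k + 1 : ℝ) := by
      rw [Metric.mem_closedBall, dist_comm]
      exact_mod_cast (NNReal.coe_lt_coe.2 (hk i)).le
    obtain ⟨c, hc, hd⟩ := Set.mem_iUnion₂.1 (ht hi)
    exact ⟨⟨c, hc⟩, hd⟩
  choose c hc using hx
  obtain ⟨i, j, hij, he⟩ := Fintype.exists_ne_map_eq_of_card_lt c (by simp)
  have hd : dist (x i) (x j) ≤ 1 / (k + 1) := by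
    have e : (1 : ℝ) / (k + 1) = 1 / (2 * (k + 1)) + 1 / (2 * (k + 1)) := by field_simp; norm_num
    rw [e]
    refine (dist_triangle_right _ _ (c i : X.carrier)).trans (add_le_add (hc i).le ?_)
    rw [he]; exact (hc j).le
  rcases lt_or_gt_of_ne hij with h | h
  · exact ⟨i, j, h, hd⟩
  · exact ⟨j, i, h, by rwa [dist_comm]⟩

theorem properSpace_core (X : PointedMMSpace) (h : ∀ k, ∃ N, X.SepBound k N) :
    ProperSpace X.core := by
  have key : ∀ r : ℝ, IsCompact (X.core ∩ Metric.closedBall X.root r) := by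
    intro r
    refine isCompact_iff_totallyBounded_isComplete.2 ⟨Metric.totallyBounded_iff.2 fun ε hε => ?_,
      (X.isClosed_core.inter Metric.isClosed_closedBall).isComplete⟩
    obtain ⟨k, hk⟩ := exists_nat_gt (max r (1 / ε))
    have hk1 : r < k + 1 := by linarith [le_max_left r (1 / ε)]
    have hk2 : 1 / (k + 1 : ℝ) < ε := by
      rw [div_lt_iff₀ (by positivity)]
      have : 1 / ε < k + 1 := by linarith [le_max_right r (1 / ε)]
      rwa [div_lt_iff₀ hε, mul_comm] at this
    obtain ⟨N, hN⟩ := h k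
    obtain ⟨p, -, -, hp⟩ := hN.exists_net
    refine ⟨p '' Set.Iic N, (Set.finite_Iic N).image p, fun x hx => ?_⟩
    have hxk : nndist X.root x < k + 1 := by
      rw [← NNReal.coe_lt_coe]
      have := hx.2
      rw [Metric.mem_closedBall, dist_comm] at this
      push_cast
      exact this.trans_lt hk1
    obtain ⟨i, hi, hd⟩ := hp x hx.1 hxk
    refine Set.mem_iUnion₂.2 ⟨p i, ⟨i, hi, rfl⟩, ?_⟩
    rw [Metric.mem_ball, dist_comm]
    exact hd.trans_lt hk2
  refine ⟨fun x r => ?_⟩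
  have := X.isClosed_core.isClosedEmbedding_subtypeVal.isCompact_preimage
    (key (r + dist (x : X.carrier) X.root))
  refine this.of_isClosed_subset Metric.isClosed_closedBall fun y hy => ⟨y.2, ?_⟩
  exact (dist_triangle _ (x : X.carrier) _).trans (add_le_add_left hy _)

end PointedMMSpace

namespace MMSpace

/-- The functionals on equivalence classes. -/
noncomputable def functional (x : MMSpace) (m k : ℕ)
    (f : C(PointedMMSpace.PairIndex m → ℝ≥0, ℝ)) : ℝ :=
  Quotient.lift (fun X => PointedMMSpace.functional X m k f)
    (fun _ _ h => PointedMMSpace.functional_eq_of_equivalent h _ _ _) x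

theorem functional_mk (X : PointedMMSpace) (m k : ℕ)
    (f : C(PointedMMSpace.PairIndex m → ℝ≥0, ℝ)) : (mk X).functional m k f = X.functional m k f :=
  rfl

theorem continuous_functional (m k : ℕ) (f : C(PointedMMSpace.PairIndex m → ℝ≥0, ℝ)) :
    Continuous fun x : MMSpace => x.functional m k f := by
  refine continuous_iff_continuousAt.2 fun x => ?_
  choose r hr using MMSpace.exists_mk
  have := PointedMMSpace.tendsto_functional_of_tendsto_coord (Xs := r) (X := r x) (l := 𝓝 x)
    (by simpa only [← coord_mk, hr] using isInducing_coord.continuous.tendsto x) m k f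
  simpa only [← functional_mk, hr, ContinuousAt] using this

theorem mk_coreSpace (X : PointedMMSpace) : mk X.coreSpace = mk X :=
  mk_eq_iff_coord.2 (funext fun _ => X.functional_coreSpace _ _ _)

/-- The classes of spaces with a separation bound. -/
def sepBound (k N : ℕ) : Set MMSpace :=
  {x | x.functional N k (PointedMMSpace.sepFun N k) = 0}

/-- The classes of spaces with support in a ball of radius `R`. -/
def farBound (R : ℝ) : Set MMSpace :=
  {x | ∀ k, x.functional 1 k (PointedMMSpace.farFun R) = 0}

theorem isClosed_sepBound (k N : ℕ) : IsClosed (sepBound k N) :=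
  isClosed_eq (continuous_functional _ _ _) continuous_const

theorem isClosed_farBound (R : ℝ) : IsClosed (farBound R) := by
  simp only [farBound, Set.ofPred_forall]
  exact isClosed_iInter fun k => isClosed_eq (continuous_functional _ _ _) continuous_const

theorem mem_heineBorel_iff {x : MMSpace} : x ∈ heineBorel ↔ ∀ k, ∃ N, x ∈ sepBound k N := by
  constructor
  · rintro ⟨X, rfl, hX⟩ k
    exact X.exists_sepBound_of_properSpace k
  · intro h
    obtain ⟨X, rfl⟩ := x.exists_mk
    exact ⟨X.coreSpace, mk_coreSpace X, X.properSpace_core h⟩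

/-- For the converse, the core is proper and coincides with one of its closed balls. -/
theorem mem_compact_iff {x : MMSpace} :
    x ∈ compact ↔ x ∈ heineBorel ∧ ∃ R : ℕ, x ∈ farBound R := by
  refine and_congr_right fun hx => ?_
  constructor
  · rintro ⟨X, rfl, hX⟩
    obtain ⟨C, hC⟩ := (isCompact_univ (X := X.carrier)).isBounded.subset_closedBall X.root
    obtain ⟨R, hR⟩ := exists_nat_ge C
    refine ⟨R, PointedMMSpace.farBound_iff.2 fun x _ => ?_⟩
    rw [dist_comm]
    exact (hC (Set.mem_univ x)).trans hR
  · rintro ⟨R, hR⟩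
    obtain ⟨X, rfl⟩ := x.exists_mk
    have hp : ProperSpace X.core := X.properSpace_core (mem_heineBorel_iff.1 hx)
    refine ⟨X.coreSpace, mk_coreSpace X, ?_⟩
    have hb := PointedMMSpace.farBound_iff.1 hR
    have e : (Set.univ : Set X.core) = Metric.closedBall ⟨X.root, X.root_mem_core⟩ R := by
      symm
      refine Set.eq_univ_of_forall fun y => ?_
      rw [Metric.mem_closedBall, dist_comm]
      rcases y.2 with hy | hy
      · exact hb _ hy
      · have : y = ⟨X.root, X.root_mem_core⟩ := Subtype.ext hy
        rw [this, dist_self]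
        exact Nat.cast_nonneg R
    have hc := isCompact_closedBall (⟨X.root, X.root_mem_core⟩ : X.core) (R : ℝ)
    rw [← e] at hc
    exact ⟨hc⟩

end MMSpace

/-! ### Vague limits and stability of the functionals under almost isometric maps. -/

section Compactness

open scoped ENNReal BoundedContinuousFunction CompactlySupported

/-- Vague limits along an ultrafilter on a proper space. -/
theorem exists_vague_limit {ι α : Type*} [MetricSpace α] [ProperSpace α] [MeasurableSpace α]
    [BorelSpace α] (U : Ultrafilter ι) (κ : ι → Measure α) [∀ n, IsBoundedlyFinite (κ n)]
    (h : ∀ K : Set α, IsCompact K → ∃ C : ℝ, ∀ n, (κ n).real K ≤ C) :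
    ∃ μ : Measure α, IsBoundedlyFinite μ ∧ ∀ g : C_c(α, ℝ),
      Tendsto (fun n => ∫ x, g x ∂(κ n)) U (𝓝 (∫ x, g x ∂μ)) := by
  have hfin : ∀ n, IsFiniteMeasureOnCompacts (κ n) := fun n =>
    ⟨fun K hK => IsBoundedlyFinite.measure_lt_top _ hK.isBounded⟩
  have hex : ∀ g : C_c(α, ℝ), ∃ y : ℝ, Tendsto (fun n => ∫ x, g x ∂(κ n)) U (𝓝 y) := by
    intro g
    obtain ⟨C, hC⟩ := h _ g.hasCompactSupport
    obtain ⟨B, hB⟩ := g.hasCompactSupport.exists_bound_of_continuous g.continuous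
    have hB0 : 0 ≤ max B 0 := le_max_right _ _
    have hbound : ∀ n, ∫ x, g x ∂(κ n) ∈ Metric.closedBall (0 : ℝ) (max B 0 * C) := fun n => by
      rw [mem_closedBall_zero_iff, ← setIntegral_eq_integral_of_forall_compl_eq_zero
        (s := tsupport g) fun x hx => image_eq_zero_of_notMem_tsupport hx]
      refine (norm_setIntegral_le_of_norm_le_const (C := max B 0)
        (hfin n |>.lt_top_of_isCompact g.hasCompactSupport) fun x _ =>
          (hB x).trans (le_max_left _ _)).trans ?_
      exact mul_le_mul_of_nonneg_left (hC n) hB0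
    -- The integrals stay in a compact interval, so they converge along the ultrafilter. The limits
    -- form a positive linear functional, which the Riesz-Markov-Kakutani theorem represents by a
    -- measure.
    obtain ⟨y, -, hy⟩ := (isCompact_closedBall (0 : ℝ) (max B 0 * C)).ultrafilter_le_nhds
      (U.map fun n => ∫ x, g x ∂(κ n)) (by
        rw [Ultrafilter.coe_map, le_principal_iff]; exact Filter.mem_map.2 (univ_mem' hbound))
    exact ⟨y, hy⟩
  choose Λ hΛ using hex
  let L : C_c(α, ℝ) →ₗ[ℝ] ℝ :=
    { toFun := Λ
      map_add' := fun f g => tendsto_nhds_unique (hΛ (f + g)) (by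
        simpa only [CompactlySupportedContinuousMap.coe_add, Pi.add_apply,
          fun n => integral_add (f.integrable (μ := κ n)) (g.integrable (μ := κ n))]
          using (hΛ f).add (hΛ g))
      map_smul' := fun c f => tendsto_nhds_unique (hΛ (c • f)) (by
        simpa only [CompactlySupportedContinuousMap.coe_smul, Pi.smul_apply, integral_smul,
          RingHom.id_apply] using (hΛ f).const_smul c) }
  let Lp : C_c(α, ℝ) →ₚ[ℝ] ℝ := PositiveLinearMap.mk₀ L fun f hf =>
    ge_of_tendsto (hΛ f) (Eventually.of_forall fun n => integral_nonneg hf)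
  refine ⟨RealRMK.rieszMeasure Lp, ⟨fun s hs => ?_⟩, fun g => ?_⟩
  · exact (measure_mono subset_closure).trans_lt hs.isCompact_closure.measure_lt_top
  · rw [RealRMK.integral_rieszMeasure]
    exact hΛ g

variable {α β : Type*} [MetricSpace α] [TopologicalSpace.SeparableSpace α]
  [MeasurableSpace α] [BorelSpace α] [MetricSpace β]
  [TopologicalSpace.SeparableSpace β] [MeasurableSpace β] [BorelSpace β]

/-- On a proper space, vague convergence implies convergence of the functionals. -/
theorem tendsto_distFunctional_of_vague {ι : Type*} {l : Filter ι} [ProperSpace α] (ρ : α)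
    (κ : ι → Measure α) (μ : Measure α) [∀ a, IsBoundedlyFinite (κ a)] [IsBoundedlyFinite μ]
    (h : ∀ g : C_c(α, ℝ), Tendsto (fun a => ∫ x, g x ∂(κ a)) l (𝓝 (∫ x, g x ∂μ))) (m k : ℕ)
    (f : C(PointedMMSpace.PairIndex m → ℝ≥0, ℝ)) :
    Tendsto (fun a => distFunctional ρ (κ a) m k f) l (𝓝 (distFunctional ρ μ m k f)) := by
  refine tendsto_distFunctional ρ κ μ k (fun g => ?_) m f
  simp_rw [integral_rootCut]
  refine h ⟨⟨fun x => (cutoff k (nndist ρ x) : ℝ) * g x, by fun_prop⟩, ?_⟩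
  refine HasCompactSupport.intro (isCompact_closedBall ρ (k + 1 : ℝ)) fun x hx => ?_
  rw [Metric.mem_closedBall, not_le, dist_comm] at hx
  have : (k + 1 : ℝ≥0) ≤ nndist ρ x := by
    rw [← NNReal.coe_le_coe]; exact_mod_cast hx.le
  simp [cutoff_eq_zero this]

/-- The function factors through the Lipschitz truncation onto a compact box. -/
theorem uniformContinuous_cutFun {m : ℕ} (k : ℕ) (f : C(PointedMMSpace.PairIndex m → ℝ≥0, ℝ)) :
    UniformContinuous (cutFun k f) := by
  have h1 : cutFun k f = cutFun k f ∘ truncMatrix m k := by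
    funext D
    have hcut : ∀ t : ℝ≥0, cutoff k (min t (2 * (k + 1))) = cutoff k t := fun t => by
      rcases le_total t (2 * (k + 1)) with ht | ht
      · rw [min_eq_left ht]
      · have : (k + 1 : ℝ≥0) ≤ 2 * (k + 1) := le_mul_of_one_le_left' one_le_two
        rw [min_eq_right ht, cutoff_eq_zero this, cutoff_eq_zero (this.trans ht)]
    change ((∏ i : Fin m, cutoff k (D (rootIndex i)) : ℝ≥0) : ℝ) * f (truncMatrix m k D) =
      ((∏ i : Fin m, cutoff k (truncMatrix m k D (rootIndex i)) : ℝ≥0) : ℝ) *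
        f (truncMatrix m k (truncMatrix m k D))
    rw [truncMatrix_eq (truncMatrix_mem m k D)]
    congr 2
    exact Finset.prod_congr rfl fun i _ => (hcut _).symm
  have h2 : UniformContinuousOn (cutFun k f) (distBox m k) :=
    (isCompact_distBox m k).uniformContinuousOn_of_continuous (cutFun k f).continuous.continuousOn
  have h3 : UniformContinuous (truncMatrix m k) := by
    refine (LipschitzWith.of_dist_le_mul (K := 1) fun D D' => ?_).uniformContinuous
    rw [NNReal.coe_one, one_mul]
    refine (dist_pi_le_iff dist_nonneg).2 fun p => ?_
    refine le_trans ?_ (dist_le_pi_dist D D' p)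
    rw [NNReal.dist_eq, NNReal.dist_eq]
    simp only [truncMatrix, NNReal.coe_min]
    exact abs_min_sub_min_le_max _ _ _ _ |>.trans (by simp)
  rw [h1]
  rw [Metric.uniformContinuous_iff]
  intro ε hε
  obtain ⟨δ, hδ, hd⟩ := Metric.uniformContinuousOn_iff.1 h2 ε hε
  obtain ⟨δ', hδ', hd'⟩ := Metric.uniformContinuous_iff.1 h3 δ hδ
  exact ⟨δ', hδ', fun _ _ h => hd _ (truncMatrix_mem _ _ _) _ (truncMatrix_mem _ _ _) (hd' h)⟩

theorem cutFun_distMat_eq_zero {γ : Type*} [MetricSpace γ] {ρ : γ} {m k : ℕ}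
    {f : C(PointedMMSpace.PairIndex m → ℝ≥0, ℝ)} {x : Fin m → γ} {i : Fin m}
    (h : (k + 1 : ℝ) ≤ dist ρ (x i)) : cutFun k f (distMat ρ m x) = 0 := by
  change ((∏ i : Fin m, cutoff k (distMat ρ m x (rootIndex i)) : ℝ≥0) : ℝ) * truncFun k f _ = 0
  rw [Finset.prod_eq_zero (Finset.mem_univ i), NNReal.coe_zero, zero_mul]
  rw [distMat_rootIndex]
  refine cutoff_eq_zero ?_
  rw [← NNReal.coe_le_coe]
  exact_mod_cast h

theorem dist_distMat_lt {γ γ' : Type*} [MetricSpace γ] [MetricSpace γ'] {ρ : γ} {σ : γ'} {δ : ℝ}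
    (hδ0 : 0 < δ) {m : ℕ} {x : Fin m → γ} {y : Fin m → γ'}
    (h0 : ∀ i, |dist σ (y i) - dist ρ (x i)| < δ)
    (h1 : ∀ i j, |dist (y i) (y j) - dist (x i) (x j)| < δ) :
    dist (distMat σ m y) (distMat ρ m x) < δ := by
  refine (dist_pi_lt_iff hδ0).2 fun p => ?_
  have key : ∀ i j : Fin (m + 1), |dist ((Fin.cons σ y : Fin (m + 1) → γ') i)
      ((Fin.cons σ y : Fin (m + 1) → γ') j) - dist ((Fin.cons ρ x : Fin (m + 1) → γ) i)
      ((Fin.cons ρ x : Fin (m + 1) → γ) j)| < δ := by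
    refine Fin.cases (Fin.cases ?_ fun j => ?_) fun i => Fin.cases ?_ fun j => ?_
    · simpa using hδ0
    · simpa using h0 j
    · simp only [Fin.cons_zero, Fin.cons_succ]
      rw [dist_comm (y i), dist_comm (x i)]
      exact h0 i
    · simpa using h1 i j
  rw [NNReal.dist_eq]
  exact key _ _

/-- The functionals change little under maps which almost preserve distances. -/
theorem abs_distFunctional_map_sub_le {ρ : α} {σ : β} {μ : Measure α} {φ : α → β}
    (hφ : Measurable φ) [IsBoundedlyFinite μ] [IsBoundedlyFinite (μ.map φ)] {δ ε : ℝ} (hδ : δ ≤ 1)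
    (hδ0 : 0 < δ)
    {S : Set α} (hS : ∀ᵐ x ∂μ, x ∈ S) (h0 : ∀ x ∈ S, |dist σ (φ x) - dist ρ x| < δ)
    (h1 : ∀ x ∈ S, ∀ y ∈ S, |dist (φ x) (φ y) - dist x y| < δ) {m k : ℕ}
    {f : C(PointedMMSpace.PairIndex m → ℝ≥0, ℝ)}
    (hf : ∀ D D', dist D D' < δ → |cutFun k f D - cutFun k f D'| ≤ ε) :
    |distFunctional σ (μ.map φ) m k f - distFunctional ρ μ m k f| ≤
      ε * distFunctional ρ μ m (k + 2) 1 := by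
  have hε : 0 ≤ ε := (abs_nonneg _).trans (hf 0 0 (by simpa using hδ0))
  have hφm : Measurable fun (x : Fin m → α) i => φ (x i) :=
    measurable_pi_lambda _ fun i => hφ.comp (measurable_pi_apply i)
  have eσ : distFunctional σ (μ.map φ) m k f = ∫ x, cutFun k f (distMat σ m fun i => φ (x i))
      ∂(Measure.pi fun _ : Fin m => μ) := by
    rw [distFunctional_eq_integral_map,
      integral_map (by fun_prop) (cutFun k f).continuous.aestronglyMeasurable,
      ← Measure.pi_map_pi fun _ => hφ.aemeasurable, integral_map hφm.aemeasurable]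
    have := continuous_distMat σ m
    exact Continuous.aestronglyMeasurable (by fun_prop)
  have eρ : distFunctional ρ μ m k f = ∫ x, cutFun k f (distMat ρ m x)
      ∂(Measure.pi fun _ : Fin m => μ) := by
    rw [distFunctional_eq_integral_map,
      integral_map (by fun_prop) (cutFun k f).continuous.aestronglyMeasurable]
  have e1 : distFunctional ρ μ m (k + 2) 1 = ∫ x, ∏ i : Fin m, (cutoff (k + 2) (nndist ρ (x i)) : ℝ)
      ∂(Measure.pi fun _ : Fin m => μ) := by
    rw [distFunctional_eq_integral_pi]
    simp
  have icut : Integrable (fun x => (cutoff (k + 2) (nndist ρ x) : ℝ)) μ := by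
    have h : ∫⁻ x, (cutoff (k + 2) (nndist ρ x) : ℝ≥0∞) ∂μ ≠ ⊤ := by
      have := measure_ne_top (rootCut ρ μ (k + 2)) Set.univ
      rwa [rootCut, withDensity_apply _ MeasurableSet.univ, Measure.restrict_univ] at this
    exact ⟨Continuous.aestronglyMeasurable (by fun_prop), hasFiniteIntegral_iff_ofNNReal.2 h.lt_top⟩
  have iprod : Integrable (fun x : Fin m → α => ∏ i, (cutoff (k + 2) (nndist ρ (x i)) : ℝ))
      (Measure.pi fun _ : Fin m => μ) := Integrable.fin_nat_prod fun _ => icut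
  have hSm : ∀ᵐ x ∂(Measure.pi fun _ : Fin m => μ), ∀ i, x i ∈ S :=
    eventually_all.2 fun i => (Measure.tendsto_eval_ae_ae (μ := fun _ : Fin m => μ)
      (i := i)).eventually hS
  have hprod0 : ∀ x : Fin m → α, 0 ≤ ∏ i, (cutoff (k + 2) (nndist ρ (x i)) : ℝ) := fun x =>
    Finset.prod_nonneg fun _ _ => NNReal.coe_nonneg _
  have hprod1 : ∀ x : Fin m → α, (∀ i, nndist ρ (x i) ≤ (k + 2 : ℕ)) →
      ∏ i, (cutoff (k + 2) (nndist ρ (x i)) : ℝ) = 1 := fun x hx =>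
    Finset.prod_eq_one fun i _ => by rw [cutoff_eq_one (hx i), NNReal.coe_one]
  -- Distances move by less than `δ ≤ 1`, so a point beyond radius `k + 2` is sent beyond `k + 1`
  -- and both integrands vanish. Otherwise the product of the cut-offs at level `k + 2` is one and
  -- dominates.
  have hfar : ∀ x : Fin m → α, (∀ i, x i ∈ S) → (¬ ∀ i, nndist ρ (x i) ≤ (k + 2 : ℕ)) →
      cutFun k f (distMat σ m fun i => φ (x i)) = 0 ∧ cutFun k f (distMat ρ m x) = 0 := by
    intro x hx hfar
    push Not at hfar
    obtain ⟨i, hi⟩ := hfar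
    have hi' : (k + 2 : ℝ) < dist ρ (x i) := by
      have := NNReal.coe_lt_coe.2 hi
      push_cast at this
      exact this
    have := (abs_lt.1 (h0 _ (hx i))).1
    exact ⟨cutFun_distMat_eq_zero (i := i) (by linarith), cutFun_distMat_eq_zero (i := i) (by linarith)⟩
  have hdiff : ∀ᵐ x ∂(Measure.pi fun _ : Fin m => μ),
      ‖cutFun k f (distMat σ m fun i => φ (x i)) - cutFun k f (distMat ρ m x)‖ ≤
        ε * ∏ i, (cutoff (k + 2) (nndist ρ (x i)) : ℝ) := by
    filter_upwards [hSm] with x hx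
    by_cases hk : ∀ i, nndist ρ (x i) ≤ (k + 2 : ℕ)
    · rw [hprod1 x hk, mul_one]
      exact hf _ _ (dist_distMat_lt hδ0 (fun i => h0 _ (hx i)) fun i j => h1 _ (hx i) _ (hx j))
    · rw [(hfar x hx hk).1, (hfar x hx hk).2, sub_zero, norm_zero]
      exact mul_nonneg hε (hprod0 x)
  have hbd : ∀ (τ : (Fin m → α) → PointedMMSpace.PairIndex m → ℝ≥0), Measurable τ →
      (∀ x : Fin m → α, (∀ i, x i ∈ S) → (¬ ∀ i, nndist ρ (x i) ≤ (k + 2 : ℕ)) →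
        cutFun k f (τ x) = 0) →
      Integrable (fun x => cutFun k f (τ x)) (Measure.pi fun _ : Fin m => μ) := by
    intro τ hτ h
    refine (iprod.const_mul ‖cutFun k f‖).mono'
      ((cutFun k f).continuous.measurable.comp hτ).aestronglyMeasurable ?_
    filter_upwards [hSm] with x hx
    by_cases hk : ∀ i, nndist ρ (x i) ≤ (k + 2 : ℕ)
    · rw [hprod1 x hk, mul_one]
      exact (cutFun k f).norm_coe_le_norm _
    · rw [h x hx hk, norm_zero]
      exact mul_nonneg (norm_nonneg _) (hprod0 x)
  have i1 := hbd (fun x => distMat σ m fun i => φ (x i))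
    ((continuous_distMat σ m).measurable.comp hφm) fun x hx hk => (hfar x hx hk).1
  have i2 := hbd (fun x => distMat ρ m x) (continuous_distMat ρ m).measurable
    fun x hx hk => (hfar x hx hk).2
  rw [eσ, eρ, e1, ← integral_sub i1 i2, ← integral_const_mul, ← Real.norm_eq_abs]
  exact norm_integral_le_of_norm_le (iprod.const_mul ε) hdiff

end Compactness

/-! ### The limit of finite nets along an ultrafilter. -/

section LimitSpace

theorem exists_completion {ι : Type} (d : ι → ι → ℝ) (h0 : ∀ i, d i i = 0)
    (hs : ∀ i j, d i j = d j i) (ht : ∀ i j k, d i k ≤ d i j + d j k) :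
    ∃ (Z : Type) (_ : MetricSpace Z) (_ : CompleteSpace Z) (z : ι → Z),
      DenseRange z ∧ ∀ i j, dist (z i) (z j) = d i j := by
  let _ : PseudoMetricSpace ι :=
    { dist := d
      dist_self := h0
      dist_comm := hs
      dist_triangle := ht }
  exact ⟨UniformSpace.Completion ι, inferInstance, inferInstance, (↑),
    UniformSpace.Completion.denseRange_coe, fun i j => UniformSpace.Completion.dist_eq i j⟩

/-- Total boundedness of balls may be tested on a dense set: half of `ε` is spent on moving to a
dense point, half on the net. -/
theorem properSpace_of_nets {Z : Type*} [MetricSpace Z] [CompleteSpace Z] (σ : Z)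
    (h : ∀ k : ℕ, ∃ t : Set Z, t.Finite ∧
      Dense {x | dist σ x < k + 1 → ∃ c ∈ t, dist c x ≤ 1 / (k + 1)}) : ProperSpace Z := by
  have key : ∀ r : ℝ, IsCompact (Metric.closedBall σ r) := by
    intro r
    refine isCompact_iff_totallyBounded_isComplete.2 ⟨Metric.totallyBounded_iff.2 fun ε hε => ?_,
      Metric.isClosed_closedBall.isComplete⟩
    obtain ⟨k, hk⟩ := exists_nat_gt (max r (2 / ε))
    have hk1 : r < k := (le_max_left _ _).trans_lt hk
    have hk2 : 1 / (k + 1 : ℝ) < ε / 2 := by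
      rw [div_lt_iff₀ (by positivity)]
      have : 2 / ε < k := (le_max_right _ _).trans_lt hk
      rw [div_lt_iff₀ hε] at this
      nlinarith
    obtain ⟨t, ht, hd⟩ := h k
    refine ⟨t, ht, fun x hx => ?_⟩
    obtain ⟨y, hy, hxy⟩ := hd.exists_dist_lt x (ε := min 1 (ε / 2)) (by positivity)
    rw [Metric.mem_closedBall, dist_comm] at hx
    obtain ⟨c, hc, hcy⟩ := hy (by
      linarith [dist_triangle σ x y, min_le_left 1 (ε / 2)])
    refine Set.mem_iUnion₂.2 ⟨c, hc, ?_⟩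
    rw [Metric.mem_ball]
    rw [dist_comm] at hcy
    linarith [dist_triangle x y c, min_le_right 1 (ε / 2)]
  exact ⟨fun x r => (key (r + dist x σ)).of_isClosed_subset Metric.isClosed_closedBall
    (Metric.closedBall_subset_closedBall' le_rfl)⟩

namespace PointedMMSpace

/-- Spaces with uniform separation bounds are, along a subsequence, almost isometrically embedded
into a proper space. -/
theorem exists_almost_embedding (Xs : ℕ → PointedMMSpace) {N : ℕ → ℕ}
    (hN : ∀ k n, (Xs n).SepBound k (N k)) :
    ∃ (Z : Type) (_ : MetricSpace Z) (_ : ProperSpace Z) (σ : Z) (ψ : ℕ → ℕ),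
      Tendsto ψ atTop atTop ∧ ∀ K : ℕ, ∃ φ : SimpleFunc (Xs (ψ K)).carrier Z,
        ∀ x ∈ (Xs (ψ K)).core, nndist (Xs (ψ K)).root x < K + 1 →
          |dist σ (φ x) - dist (Xs (ψ K)).root x| < 3 / (K + 1) ∧
          ∀ y ∈ (Xs (ψ K)).core, nndist (Xs (ψ K)).root y < K + 1 →
            |dist (φ x) (φ y) - dist x y| < 3 / (K + 1) := by
  choose p hp0 hpk hpN using fun n k => (hN k n).exists_net
  have hroot : ∀ n (a : ℕ × ℕ), dist (Xs n).root (p n a.1 a.2) ≤ a.1 + 1 := fun n a => by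
    exact_mod_cast NNReal.coe_le_coe.2 (hpk n a.1 a.2).2
  -- A nonprincipal ultrafilter replaces diagonal extraction: all distances between net points are
  -- bounded, so they converge simultaneously to a pseudometric on the index set.
  let U : Ultrafilter ℕ := hyperfilter ℕ
  have hU : (U : Filter ℕ) ≤ atTop := by
    rw [← Nat.cofinite_eq_atTop]; exact hyperfilter_le_cofinite
  have hlim : ∀ a b : ℕ × ℕ, ∃ y : ℝ,
      Tendsto (fun n => dist (p n a.1 a.2) (p n b.1 b.2)) U (𝓝 y) := fun a b => by
    obtain ⟨y, -, hy⟩ := (isCompact_Icc (a := (0 : ℝ)) (b := (a.1 + 1) + (b.1 + 1))).ultrafilter_le_nhds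
      (U.map fun n => dist (p n a.1 a.2) (p n b.1 b.2)) (by
        rw [Ultrafilter.coe_map, le_principal_iff]
        exact Filter.mem_map.2 (univ_mem' fun n => ⟨dist_nonneg,
          (dist_triangle_left _ _ (Xs n).root).trans (add_le_add (hroot n a) (hroot n b))⟩))
    exact ⟨y, hy⟩
  choose d hd using hlim
  obtain ⟨Z, _, _, z, hz, hzd⟩ := exists_completion d
    (fun a => tendsto_nhds_unique (hd a a) (by simp))
    (fun a b => tendsto_nhds_unique (hd a b) (by simpa only [dist_comm] using hd b a))
    (fun a b c => le_of_tendsto_of_tendsto' (hd a c) ((hd a b).add (hd b c)) fun n =>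
      dist_triangle _ _ _)
  have hz0 : ∀ k, z (k, 0) = z (0, 0) := fun k => by
    rw [← dist_eq_zero, hzd]
    exact tendsto_nhds_unique (hd _ _) (by simp [hp0])
  have hproper : ProperSpace Z := by
    refine properSpace_of_nets (z (0, 0)) fun k => ⟨(fun i => z (k, i)) '' Set.Iic (N k),
      (Set.finite_Iic _).image _, hz.mono ?_⟩
    rintro _ ⟨b, rfl⟩ hb
    rw [hzd] at hb
    have h1 : ∀ᶠ n in (U : Filter ℕ), ∃ i ∈ Set.Iic (N k),
        dist (p n k i) (p n b.1 b.2) ≤ 1 / (k + 1) := by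
      filter_upwards [(hd _ _).eventually_lt_const hb] with n hn
      rw [hp0, dist_nndist] at hn
      exact hpN n k _ (hpk n b.1 b.2).1 (by exact_mod_cast hn)
    -- The near net point may depend on `n`, but only finitely many indices occur, and the
    -- ultrafilter selects one of them.
    have h2 : (⋃ i ∈ Set.Iic (N k), {n | dist (p n k i) (p n b.1 b.2) ≤ 1 / (k + 1 : ℝ)}) ∈ U := by
      filter_upwards [h1] with n hn
      obtain ⟨i, hi, h⟩ := hn
      exact Set.mem_iUnion₂.2 ⟨i, hi, h⟩
    obtain ⟨i, hi, h⟩ := (Ultrafilter.finite_biUnion_mem_iff (Set.finite_Iic (N k))).1 h2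
    refine ⟨z (k, i), ⟨i, hi, rfl⟩, ?_⟩
    rw [hzd]
    exact le_of_tendsto (hd (k, i) b) h
  have hψ : ∀ K : ℕ, ∃ n, K ≤ n ∧ ∀ i ∈ Set.Iic (N K), ∀ j ∈ Set.Iic (N K),
      |d (K, i) (K, j) - dist (p n K i) (p n K j)| < 1 / (K + 1) := fun K => by
    have hev : ∀ᶠ n in (U : Filter ℕ), K ≤ n := hU (mem_atTop K)
    refine (hev.and ?_).exists
    refine ((Set.finite_Iic (N K)).eventually_all).2 fun i _ =>
      ((Set.finite_Iic (N K)).eventually_all).2 fun j _ => ?_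
    filter_upwards [Metric.tendsto_nhds.1 (hd (K, i) (K, j)) (1 / (K + 1)) (by positivity)] with n hn
    rwa [dist_comm, Real.dist_eq] at hn
  choose ψ hψK hψd using hψ
  refine ⟨Z, inferInstance, hproper, z (0, 0), ψ, tendsto_atTop_mono hψK tendsto_id, fun K => ?_⟩
  -- Each point is sent to the limit of its nearest net point. Two moves to the net and one
  -- comparison of net distances with their limits cost `1 / (K + 1)` each.
  let ind := SimpleFunc.nearestPtInd (p (ψ K) K) (N K)
  have hind : ∀ x, ind x ∈ Set.Iic (N K) := fun x => SimpleFunc.nearestPtInd_le _ _ _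
  have hnear : ∀ x ∈ (Xs (ψ K)).core, nndist (Xs (ψ K)).root x < K + 1 →
      dist (p (ψ K) K (ind x)) x ≤ 1 / (K + 1) := fun x hx hxK => by
    obtain ⟨i, hi, h⟩ := hpN (ψ K) K x hx hxK
    refine le_trans ?_ h
    have := SimpleFunc.edist_nearestPt_le (p (ψ K) K) x hi
    rw [edist_dist, edist_dist, ENNReal.ofReal_le_ofReal_iff dist_nonneg] at this
    exact this
  have e3 : (3 : ℝ) / (K + 1) = 1 / (K + 1) + 1 / (K + 1) + 1 / (K + 1) := by ring
  have hpos : (0 : ℝ) < 1 / (K + 1) := by positivity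
  refine ⟨ind.map fun i => z (K, i), fun x hx hxK => ⟨?_, fun y hy hyK => ?_⟩⟩
  · have h1 := abs_lt.1 (hψd K 0 (Nat.zero_le _) _ (hind x))
    rw [hp0] at h1
    have h2 := abs_le.1 ((abs_dist_sub_le (p (ψ K) K (ind x)) x (Xs (ψ K)).root).trans
      (hnear x hx hxK))
    rw [dist_comm _ (Xs (ψ K)).root, dist_comm _ (Xs (ψ K)).root] at h2
    rw [SimpleFunc.map_apply, ← hz0 K, hzd, abs_lt, e3]
    constructor <;> linarith
  · have h1 := abs_lt.1 (hψd K _ (hind x) _ (hind y))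
    have h2 := abs_le.1 ((abs_dist_sub_le (p (ψ K) K (ind x)) x (p (ψ K) K (ind y))).trans
      (hnear x hx hxK))
    have h3 := abs_le.1 ((abs_dist_sub_le (p (ψ K) K (ind y)) y x).trans (hnear y hy hyK))
    rw [dist_comm y x, dist_comm _ x] at h3
    rw [SimpleFunc.map_apply, SimpleFunc.map_apply, hzd, abs_lt, e3]
    constructor <;> linarith

end PointedMMSpace

end LimitSpace

/-! ### Existence of limits under uniform separation bounds. -/

section LimitSpace

open scoped CompactlySupported

/-- The mass of a set in a ball is bounded by a functional. -/
theorem measureReal_le_distFunctional {α : Type*} [MetricSpace α]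
    [TopologicalSpace.SeparableSpace α] [MeasurableSpace α] [BorelSpace α] (ρ : α) (μ : Measure α)
    [IsBoundedlyFinite μ] {k : ℕ} {s : Set α} (hs : s ⊆ Metric.closedBall ρ k) :
    μ.real s ≤ distFunctional ρ μ 1 k 1 := by
  rw [distFunctional_one_one]
  have h : μ.restrict (Metric.closedBall ρ k) Set.univ ≤ rootCut ρ μ k Set.univ := by
    rw [← restrict_rootCut ρ μ k le_rfl]
    exact Measure.restrict_le_self _
  rw [Measure.restrict_apply_univ] at h
  exact ENNReal.toReal_mono (measure_ne_top _ _) ((measure_mono hs).trans h)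

namespace PointedMMSpace

/-- Sequences of spaces with uniform separation bounds and convergent coordinates have a limit. -/
theorem exists_coord_eq_of_sepBound (Xs : ℕ → PointedMMSpace) {N : ℕ → ℕ}
    (hN : ∀ k n, (Xs n).SepBound k (N k)) {y : ℕ × ℕ × ℕ → ℝ}
    (hy : Tendsto (fun n => (Xs n).coord) atTop (𝓝 y)) : ∃ X : PointedMMSpace, X.coord = y := by
  obtain ⟨Z, _, _, σ, ψ, hψ, hφ⟩ := exists_almost_embedding Xs hN
  let _ : MeasurableSpace Z := borel Z
  have _ : BorelSpace Z := ⟨rfl⟩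
  choose φ h0 h1 using hφ
  -- Restriction to radius `K` keeps the mass where `φ K` almost preserves distances, and does not
  -- affect the functionals with `k + 1 ≤ K`.
  let μ := fun K : ℕ => (Xs (ψ K)).measure.restrict (Metric.closedBall (Xs (ψ K)).root K)
  have hμfin : ∀ K, IsFiniteMeasure (μ K) := fun K => isFiniteMeasure_restrictBall (Xs (ψ K)) K
  have hμ : ∀ K, IsBoundedlyFinite (μ K) := fun K => ⟨fun s _ => measure_lt_top _ s⟩
  let κ := fun K : ℕ => (μ K).map (φ K)
  have hκ : ∀ K, IsBoundedlyFinite (κ K) := fun K => ⟨fun s _ => measure_lt_top _ s⟩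
  have hμX : ∀ {K k : ℕ}, k + 1 ≤ K → ∀ m f,
      distFunctional (Xs (ψ K)).root (μ K) m k f = (Xs (ψ K)).functional m k f := by
    intro K k hk m f
    have hk' : (k + 1 : ℝ) ≤ K := by exact_mod_cast hk
    rw [functional, distFunctional_eq, distFunctional_eq, rootCut_restrict_closedBall _ _ _ hk']
  have hae : ∀ K, ∀ᵐ x ∂(μ K), x ∈ {x | x ∈ (Xs (ψ K)).core ∧ nndist (Xs (ψ K)).root x < K + 1} := by
    intro K
    have hc : ∀ᵐ x ∂(μ K), x ∈ (Xs (ψ K)).core :=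
      ae_restrict_of_ae (mem_ae_iff.2 (Xs (ψ K)).measure_compl_core)
    filter_upwards [hc, ae_restrict_mem Metric.isClosed_closedBall.measurableSet] with x hx hxK
    refine ⟨hx, ?_⟩
    rw [Metric.mem_closedBall, dist_comm] at hxK
    rw [← NNReal.coe_lt_coe]
    push_cast
    exact hxK.trans_lt (lt_add_one _)
  have hlim : ∀ m k j, Tendsto (fun K => distFunctional σ (κ K) m k (testFun m j)) atTop
      (𝓝 (y (m, k, j))) := by
    intro m k j
    have hyψ := fun i => (tendsto_pi_nhds.1 hy i).comp hψ
    have hb : Tendsto (fun K => (Xs (ψ K)).functional m (k + 2) 1) atTop (𝓝 (y (m, k + 2, 0))) :=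
      hyψ (m, k + 2, 0)
    have hj : Tendsto (fun K => (Xs (ψ K)).functional m k (testFun m j)) atTop (𝓝 (y (m, k, j))) :=
      hyψ (m, k, j)
    obtain ⟨B, hB⟩ := hb.bddAbove_range
    have hB' : ∀ K, (Xs (ψ K)).functional m (k + 2) 1 ≤ B := fun K => hB ⟨K, rfl⟩
    have hB0 : 0 ≤ B := (functional_one_nonneg _ _ _).trans (hB' 0)
    suffices hsub : Tendsto (fun K => distFunctional σ (κ K) m k (testFun m j) -
        (Xs (ψ K)).functional m k (testFun m j)) atTop (𝓝 0) by
      simpa using hsub.add hj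
    rw [Metric.tendsto_nhds]
    intro ε hε
    obtain ⟨δ, hδ, hf⟩ := Metric.uniformContinuous_iff.1
      (uniformContinuous_cutFun k (testFun m j)) (ε / (B + 1)) (by positivity)
    have hsmall : Tendsto (fun K : ℕ => (3 : ℝ) / (K + 1)) atTop (𝓝 0) := by
      have := (tendsto_one_div_add_atTop_nhds_zero_nat (𝕜 := ℝ)).const_mul 3
      simpa [div_eq_mul_inv] using this
    -- `k + 3 ≤ K` ensures that neither the functional at level `k` nor the dominating one at level
    -- `k + 2` sees the restriction.
    filter_upwards [hsmall.eventually_lt_const hδ, hsmall.eventually_lt_const one_pos,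
      eventually_ge_atTop (k + 3)] with K hKδ hK1 hKk
    have := abs_distFunctional_map_sub_le (σ := σ) (ρ := (Xs (ψ K)).root) (μ := μ K) (φ := φ K)
      (φ K).measurable hK1.le (by positivity) (hae K)
      (fun x hx => h0 K x hx.1 hx.2) (fun x hx y hy => h1 K x hx.1 hx.2 y hy.1 hy.2)
      (f := testFun m j) fun D D' h => (hf (h.trans hKδ)).le
    rw [hμX (by omega), hμX (by omega)] at this
    rw [Real.dist_eq, sub_zero]
    refine this.trans_lt ?_
    calc ε / (B + 1) * (Xs (ψ K)).functional m (k + 2) 1 ≤ ε / (B + 1) * B := by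
          gcongr; exact hB' K
      _ < ε / (B + 1) * (B + 1) := by gcongr; linarith
      _ = ε := by field_simp
  have hmass : ∀ C : Set Z, IsCompact C → ∃ M : ℝ, ∀ K, (κ K).real C ≤ M := by
    intro C hC
    obtain ⟨R, hR⟩ := hC.isBounded.subset_closedBall σ
    obtain ⟨k, hk⟩ := exists_nat_ge R
    obtain ⟨M, hM⟩ := (hlim 1 k 0).bddAbove_range
    exact ⟨M, fun K => (measureReal_le_distFunctional σ (κ K)
      (hR.trans (Metric.closedBall_subset_closedBall hk))).trans (hM ⟨K, rfl⟩)⟩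
  obtain ⟨ν, hν, hνlim⟩ := exists_vague_limit (hyperfilter ℕ) κ hmass
  have hU : (hyperfilter ℕ : Filter ℕ) ≤ atTop := by
    rw [← Nat.cofinite_eq_atTop]; exact hyperfilter_le_cofinite
  refine ⟨⟨Z, σ, ν, hν.measure_lt_top⟩, funext fun ⟨m, k, j⟩ => ?_⟩
  exact tendsto_nhds_unique (tendsto_distFunctional_of_vague σ κ ν hνlim m k (testFun m j))
    ((hlim m k j).mono_left hU)

end PointedMMSpace

end LimitSpace

/-! ### Lusin spaces from Borel sets of coordinates and separation bounds. -/

section Lusin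

/-- A continuous bijective image of a Borel subset of a Polish space is a Lusin space. -/
theorem isLusinSpace_of_measurableSet.{u, v} {E : Type u} [TopologicalSpace E] [PolishSpace E]
    [MeasurableSpace E] [BorelSpace E] {X : Type max u v} [TopologicalSpace X]
    [TopologicalSpace.MetrizableSpace X] {s : Set E} (hs : MeasurableSet s) (f : s → X)
    (hf : Continuous f) (hb : Function.Bijective f) : IsLusinSpace X := by
  refine ⟨inferInstance, ?_⟩
  let τ : TopologicalSpace s := instTopologicalSpaceSubtype
  -- A Borel set is closed in some finer Polish topology, hence Polish itself; `ULift` only adjusts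
  -- the universe.
  obtain ⟨t, ht, hp, hcl, -⟩ := hs.isClopenable
  let ts : TopologicalSpace s := @instTopologicalSpaceSubtype E (· ∈ s) t
  have hps : @PolishSpace s ts := @IsClosed.polishSpace E t hp s hcl
  have hle : ts ≤ τ := induced_mono ht
  let tu : TopologicalSpace (ULift.{v} s) := @ULift.topologicalSpace s ts
  refine ⟨ULift.{v} s, tu, f ∘ ULift.down, ?_, ?_, hb.comp Equiv.ulift.bijective⟩
  · exact (@Homeomorph.isClosedEmbedding _ _ tu ts (@Homeomorph.ulift s ts)).polishSpace
  · exact (continuous_le_dom hle hf).comp (@continuous_uliftDown s ts)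

namespace MMSpace

instance : TopologicalSpace.MetrizableSpace MMSpace := isEmbedding_coord.metrizableSpace

/-- The coordinates of the spaces with prescribed separation bounds. -/
def boundedCoords : Set ((ℕ × ℕ × ℕ → ℝ) × (ℕ → ℕ)) :=
  {q | ∃ x : MMSpace, x.coord = q.1 ∧ ∀ k, x ∈ sepBound k (q.2 k)}

/-- A convergent sequence of bounds is bounded for each `k`, so the precompactness result provides a
limit space. The bounds are eventually constant in each coordinate, and each fixed bound is a closed
condition. -/
theorem isClosed_boundedCoords : IsClosed boundedCoords := by
  refine IsSeqClosed.isClosed fun q p hq hqp => ?_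
  have h1 : ∀ n, ∃ X : PointedMMSpace, X.coord = (q n).1 ∧ ∀ k, X.SepBound k ((q n).2 k) := by
    intro n
    obtain ⟨x, hx, hxk⟩ := hq n
    obtain ⟨X, rfl⟩ := x.exists_mk
    exact ⟨X, hx, hxk⟩
  choose Xs hXs hsep using h1
  have hq1 : Tendsto (fun n => (Xs n).coord) atTop (𝓝 p.1) := by
    simp only [hXs]
    exact (continuous_fst.tendsto p).comp hqp
  have hq2 : ∀ k, Tendsto (fun n => (q n).2 k) atTop (𝓝 (p.2 k)) := fun k =>
    (((continuous_apply k).comp continuous_snd).tendsto p).comp hqp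
  choose N hN using fun k => (hq2 k).bddAbove_range
  obtain ⟨X, hX⟩ := PointedMMSpace.exists_coord_eq_of_sepBound Xs (N := N)
    (fun k n => (hsep n k).mono (hN k ⟨n, rfl⟩)) hq1
  refine ⟨mk X, hX, fun k => ?_⟩
  have hlim : Tendsto (fun n => mk (Xs n)) atTop (𝓝 (mk X)) := by
    rw [isEmbedding_coord.tendsto_nhds_iff, coord_mk, hX]
    exact hq1
  refine (isClosed_sepBound k (p.2 k)).mem_of_tendsto hlim ?_
  filter_upwards [(tendsto_pure.1 (by simpa only [nhds_discrete] using hq2 k))] with n hn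
  rw [← hn]
  exact hsep n k

/-- The coordinates of the Heine-Borel spaces together with the minimal separation bounds. -/
def minimalCoords : Set ((ℕ × ℕ × ℕ → ℝ) × (ℕ → ℕ)) :=
  {q | q ∈ boundedCoords ∧ ∀ k n, n < q.2 k → (q.1, Function.update q.2 k n) ∉ boundedCoords}

theorem measurableSet_minimalCoords : MeasurableSet minimalCoords := by
  have hc := isClosed_boundedCoords.measurableSet
  have e : minimalCoords = boundedCoords ∩ ⋂ (k : ℕ) (n : ℕ),
      ({q | n < q.2 k}ᶜ ∪ ((fun q : (ℕ × ℕ × ℕ → ℝ) × (ℕ → ℕ) =>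
        (q.1, Function.update q.2 k n)) ⁻¹' boundedCoords)ᶜ) := by
    ext q
    simp [minimalCoords, imp_iff_not_or]
  rw [e]
  refine hc.inter (MeasurableSet.iInter fun k => MeasurableSet.iInter fun n => ?_)
  have hcont : Continuous fun q : (ℕ × ℕ × ℕ → ℝ) × (ℕ → ℕ) =>
      (q.1, Function.update q.2 k n) := by fun_prop
  refine MeasurableSet.union ?_ (isClosed_boundedCoords.preimage hcont).measurableSet.compl
  exact (isOpen_lt (f := fun _ => n) (by fun_prop) (by fun_prop)).measurableSet.compl

theorem mem_boundedCoords_iff {x : MMSpace} {N : ℕ → ℕ} :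
    (x.coord, N) ∈ boundedCoords ↔ ∀ k, x ∈ sepBound k (N k) := by
  refine ⟨fun ⟨y, hy, h⟩ => ?_, fun h => ⟨x, rfl, h⟩⟩
  rwa [← isEmbedding_coord.injective hy]

theorem exists_of_mem_minimalCoords {q : (ℕ × ℕ × ℕ → ℝ) × (ℕ → ℕ)} (hq : q ∈ minimalCoords) :
    ∃ x : heineBorel, x.1.coord = q.1 := by
  obtain ⟨x, hx, h⟩ := hq.1
  exact ⟨⟨x, mem_heineBorel_iff.2 fun k => ⟨_, h k⟩⟩, hx⟩

theorem isLusinSpace_heineBorel : IsLusinSpace heineBorel := by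
  choose f hf using fun q : minimalCoords => exists_of_mem_minimalCoords q.2
  refine isLusinSpace_of_measurableSet.{0, 1} measurableSet_minimalCoords f ?_ ⟨?_, ?_⟩
  · refine (isEmbedding_coord.comp IsEmbedding.subtypeVal).continuous_iff.2 ?_
    have : (coord ∘ Subtype.val) ∘ f = fun q => q.1.1 := funext hf
    rw [this]
    fun_prop
  · rintro ⟨⟨y, N⟩, hq⟩ ⟨⟨y', N'⟩, hq'⟩ h
    have h1 := hf ⟨(y, N), hq⟩
    have h2 := hf ⟨(y', N'), hq'⟩
    rw [← h] at h2
    simp only at h1 h2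
    generalize f ⟨(y, N), hq⟩ = x at h1 h2
    subst h1
    subst h2
    -- The bounds for different `k` are independent, so replacing `N k` by a smaller admissible `N'
    -- k` would contradict minimality.
    have key : ∀ {N N' : ℕ → ℕ}, (x.1.coord, N) ∈ minimalCoords →
        (x.1.coord, N') ∈ minimalCoords → ∀ k, N k ≤ N' k := by
      intro N N' hN hN' k
      by_contra hlt
      refine hN.2 k (N' k) (not_le.1 hlt) (mem_boundedCoords_iff.2 fun l => ?_)
      have h1 := mem_boundedCoords_iff.1 hN.1
      have h2 := mem_boundedCoords_iff.1 hN'.1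
      by_cases hl : l = k
      · subst hl
        simpa using h2 l
      · simpa [hl] using h1 l
    have : N = N' := funext fun k => le_antisymm (key hq hq' k) (key hq' hq k)
    subst this
    rfl
  · intro x
    classical
    have hx := mem_heineBorel_iff.1 x.2
    have hmem : (x.1.coord, fun k => Nat.find (hx k)) ∈ minimalCoords := by
      refine ⟨mem_boundedCoords_iff.2 fun k => Nat.find_spec (hx k), fun k n hn h => ?_⟩
      have := mem_boundedCoords_iff.1 h k
      rw [Function.update_self] at this
      exact Nat.find_min (hx k) hn this
    refine ⟨⟨_, hmem⟩, Subtype.ext (isEmbedding_coord.injective (hf ⟨_, hmem⟩))⟩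

theorem isLusinSpace_compact : IsLusinSpace compact := by
  obtain ⟨-, P, _, f, _, hf, hb⟩ := isLusinSpace_heineBorel
  let _ : MeasurableSpace P := borel P
  have _ : BorelSpace P := ⟨rfl⟩
  have hs : MeasurableSet {q : P | (f q).1 ∈ compact} := by
    have e : {q : P | (f q).1 ∈ compact} = ⋃ R : ℕ, {q : P | (f q).1 ∈ farBound R} := by
      ext q
      simp [mem_compact_iff]
    rw [e]
    exact MeasurableSet.iUnion fun R =>
      ((isClosed_farBound R).preimage (continuous_subtype_val.comp hf)).measurableSet
  refine isLusinSpace_of_measurableSet.{1, 0} hs (fun q => ⟨(f q).1, q.2⟩) (by fun_prop)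
    ⟨fun q q' h => ?_, fun x => ?_⟩
  · have h' : (f q).1 = (f q').1 := congrArg (fun z : compact => z.1) h
    exact Subtype.ext (hb.injective (Subtype.ext h'))
  · obtain ⟨q, hq⟩ := hb.surjective ⟨x.1, x.2.1⟩
    have hq' : (f q).1 = x.1 := congrArg Subtype.val hq
    have hqc : (f q).1 ∈ compact := hq' ▸ x.2
    exact ⟨⟨q, hqc⟩, Subtype.ext hq'⟩

end MMSpace

end Lusin

/-! ### Small perturbations and the failure of Polishness. -/

section Perturbation

open scoped BoundedContinuousFunction

/-- The cut-off measure is linear in the measure, so the added term contributes integrals of order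
`c n`. -/
theorem tendsto_distFunctional_add_smul {α : Type*} [MetricSpace α]
    [TopologicalSpace.SeparableSpace α] [MeasurableSpace α] [BorelSpace α] (ρ : α)
    (μ τ : Measure α) [IsBoundedlyFinite μ] [IsFiniteMeasure τ] {c : ℕ → ℝ≥0}
    [∀ n, IsBoundedlyFinite (μ + c n • τ)]
    (hc : Tendsto c atTop (𝓝 0)) (m k : ℕ) (f : C(PointedMMSpace.PairIndex m → ℝ≥0, ℝ)) :
    Tendsto (fun n => distFunctional ρ (μ + c n • τ) m k f) atTop
      (𝓝 (distFunctional ρ μ m k f)) := by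
  have hτ : IsBoundedlyFinite τ := ⟨fun s _ => measure_lt_top τ s⟩
  refine tendsto_distFunctional ρ _ μ k (fun g => ?_) m f
  have e : ∀ n, ∫ x, g x ∂(rootCut ρ (μ + c n • τ) k) =
      ∫ x, g x ∂(rootCut ρ μ k) + (c n : ℝ) * ∫ x, g x ∂(rootCut ρ τ k) := fun n => by
    have : rootCut ρ (μ + c n • τ) k = rootCut ρ μ k + c n • rootCut ρ τ k := by
      rw [rootCut, withDensity_add_measure]
      congr 1
      exact withDensity_smul_measure _ _
    rw [this, integral_add_measure (g.integrable _) ((g.integrable _).smul_measure_nnreal),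
      integral_smul_nnreal_measure]
    rfl
  simp_rw [e]
  have hc' : Tendsto (fun n => (c n : ℝ)) atTop (𝓝 0) := NNReal.tendsto_coe.2 hc
  simpa using (hc'.mul_const (∫ x, g x ∂(rootCut ρ τ k))).const_add (∫ x, g x ∂(rootCut ρ μ k))

theorem IsBoundedlyFinite.map_isometry {α β : Type*} [MetricSpace α] [MeasurableSpace α]
    [BorelSpace α] [MetricSpace β] [MeasurableSpace β] [BorelSpace β] {φ : α → β}
    (hφ : Isometry φ) (μ : Measure α) [IsBoundedlyFinite μ] : IsBoundedlyFinite (μ.map φ) := by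
  refine ⟨fun s hs => (measure_mono subset_closure).trans_lt ?_⟩
  rw [Measure.map_apply hφ.continuous.measurable isClosed_closure.measurableSet]
  exact IsBoundedlyFinite.measure_lt_top _
    (hφ.antilipschitz.isBounded_preimage hs.closure)

instance IsBoundedlyFinite.add_isFiniteMeasure {α : Type*} [MetricSpace α] [MeasurableSpace α]
    (μ τ : Measure α) [IsBoundedlyFinite μ] [IsFiniteMeasure τ] : IsBoundedlyFinite (μ + τ) :=
  ⟨fun s hs => ENNReal.add_lt_top.2 ⟨IsBoundedlyFinite.measure_lt_top s hs, MeasureTheory.measure_lt_top τ s⟩⟩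

theorem mem_support_add_smul_sum_dirac {α ι : Type*} [TopologicalSpace α] [MeasurableSpace α]
    [Fintype ι] (μ : Measure α) {c : ℝ≥0} (hc : 0 < c) (x : ι → α) (i : ι) :
    x i ∈ (μ + c • ∑ j, Measure.dirac (x j)).support := by
  refine (Measure.mem_support_iff_forall _).2 fun U hU => ?_
  have h1 : 1 ≤ (∑ j, Measure.dirac (x j)) U := by
    rw [Measure.finsetSum_apply]
    refine le_trans ?_ (Finset.single_le_sum (fun _ _ => zero_le) (Finset.mem_univ i))
    rw [Measure.dirac_apply_of_mem (mem_of_mem_nhds hU)]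
  have h2 : 0 < (c • ∑ j, Measure.dirac (x j)) U := by
    rw [Measure.smul_apply, ENNReal.smul_def, smul_eq_mul]
    exact ENNReal.mul_pos (by exact_mod_cast hc.ne') (zero_lt_one.trans_le h1).ne'
  exact h2.trans_le le_add_self

namespace PointedMMSpace

theorem isometry_prod_zero (X : PointedMMSpace) (N : ℕ) :
    Isometry fun x : X.carrier => (x, (0 : Fin N → unitInterval)) := fun x y => by
  simp [Prod.edist_eq]

/-- The space `X × [0, 1]^N`, whose measure is `μ` on `X × {0}` together with atoms of mass `c`
above the root at the unit vectors. -/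
noncomputable def perturb (X : PointedMMSpace) (N : ℕ) (c : ℝ≥0) : PointedMMSpace where
  carrier := X.carrier × (Fin N → unitInterval)
  borelSpace := by
    have := X.secondCountable
    infer_instance
  root := (X.root, 0)
  measure := X.measure.map (fun x => (x, 0)) + c • ∑ i, Measure.dirac (X.root, Pi.single i 1)
  boundedlyFinite := by
    have := X.secondCountable
    have := IsBoundedlyFinite.map_isometry (X.isometry_prod_zero N) X.measure
    exact (IsBoundedlyFinite.add_isFiniteMeasure _ _).measure_lt_top

theorem tendsto_perturb (X : PointedMMSpace) (N : ℕ) :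
    Tendsto (fun n : ℕ => MMSpace.mk (X.perturb N (1 / (n + 1)))) atTop (𝓝 (MMSpace.mk X)) := by
  have := X.secondCountable
  have := IsBoundedlyFinite.map_isometry (X.isometry_prod_zero N) X.measure
  rw [MMSpace.isEmbedding_coord.tendsto_nhds_iff]
  refine tendsto_pi_nhds.2 fun i => ?_
  have h := tendsto_distFunctional_add_smul (X.root, (0 : Fin N → unitInterval))
    (X.measure.map fun x => (x, 0)) (∑ i, Measure.dirac (X.root, Pi.single i 1))
    (c := fun n : ℕ => 1 / (n + 1)) tendsto_one_div_add_atTop_nhds_zero_nat i.1 i.2.1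
    (testFun i.1 i.2.2)
  rw [distFunctional_map (X.isometry_prod_zero N)] at h
  exact h

theorem mem_support_perturb (X : PointedMMSpace) {N : ℕ} {c : ℝ≥0} (hc : 0 < c) (i : Fin N) :
    ((X.root, Pi.single i 1) : (X.perturb N c).carrier) ∈ (X.perturb N c).measure.support :=
  mem_support_add_smul_sum_dirac _ hc _ i

/-- The atoms have mutual distance one, more than `1 / (1 + 1)`, and distance at most one from the
root, within radius `2`. -/
theorem not_sepBound_perturb (X : PointedMMSpace) (N : ℕ) {c : ℝ≥0} (hc : 0 < c) :
    ¬ (X.perturb N c).SepBound 1 N := by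
  rw [sepBound_iff]
  intro h
  obtain ⟨i, j, hij, hd⟩ := h (fun i => (X.root, Pi.single i 1)) (X.mem_support_perturb hc)
    fun i => by
      change max (nndist X.root X.root) (nndist (0 : Fin N → unitInterval) (Pi.single i 1)) < _
      have h1 : ∀ t : unitInterval, nndist 0 t ≤ 1 := fun t => by
        rw [← NNReal.coe_le_coe, coe_nndist, Subtype.dist_eq, dist_comm]
        simpa [abs_of_nonneg t.2.1] using t.2.2
      have hle : nndist (0 : Fin N → unitInterval) (Pi.single i 1) ≤ 1 :=
        nndist_pi_le_iff.2 fun j => h1 _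
      rw [nndist_self]
      exact (max_le zero_le_one hle).trans_lt (by norm_num)
  have h1 : (1 : ℝ) ≤ dist (Pi.single i 1 : Fin N → unitInterval) (Pi.single j 1) := by
    refine le_trans ?_ (dist_le_pi_dist _ _ i)
    simp [hij.ne, Subtype.dist_eq]
  have h2 : dist (Pi.single i 1 : Fin N → unitInterval) (Pi.single j 1) ≤ 1 / ((1 : ℕ) + 1) :=
    (le_max_right _ _).trans hd
  norm_num at h2
  linarith

/-- The space with a single point and the zero measure. -/
noncomputable def point : PointedMMSpace where
  carrier := PUnit
  root := PUnit.unit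
  measure := 0
  boundedlyFinite := by simp

end PointedMMSpace

namespace MMSpace

/-- A set of Heine-Borel spaces which is stable under perturbations is not Polish. -/
theorem not_polishSpace_of_perturb {S : Set MMSpace} (hS : S ⊆ heineBorel) (hne : S.Nonempty)
    (h : ∀ x ∈ S, ∃ X, mk X = x ∧ ∀ N c, mk (X.perturb N c) ∈ S) : ¬ PolishSpace S := by
  intro hP
  have := hne.to_subtype
  let _ := TopologicalSpace.upgradeIsCompletelyMetrizable S
  -- Baire's theorem: some `N` works on a nonempty open set, and the perturbations by `N` atoms
  -- enter that set without leaving `S`.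
  obtain ⟨N, ⟨x, hx⟩, hxN⟩ := nonempty_interior_of_iUnion_of_closed (X := S)
    (f := fun N : ℕ => Subtype.val ⁻¹' sepBound 1 N)
    (fun N => (isClosed_sepBound 1 N).preimage continuous_subtype_val)
    (Set.iUnion_eq_univ_iff.2 fun x => mem_heineBorel_iff.1 (hS x.2) 1)
  obtain ⟨X, rfl, hX⟩ := h x hx
  have hlim : Tendsto (fun n : ℕ => (⟨_, hX N (1 / (n + 1))⟩ : S)) atTop (𝓝 ⟨mk X, hx⟩) :=
    tendsto_subtype_rng.2 (X.tendsto_perturb N)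
  obtain ⟨n, hn⟩ := (hlim.eventually_mem (mem_interior_iff_mem_nhds.1 hxN)).exists
  exact X.not_sepBound_perturb N (by positivity) hn

theorem mk_point_mem_compact : mk PointedMMSpace.point ∈ compact := by
  have : CompactSpace PointedMMSpace.point.carrier := inferInstanceAs (CompactSpace PUnit)
  exact ⟨⟨_, rfl, inferInstance⟩, _, rfl, this⟩

theorem not_polishSpace_heineBorel : ¬ PolishSpace heineBorel := by
  refine not_polishSpace_of_perturb subset_rfl ⟨_, mk_point_mem_compact.1⟩ ?_
  rintro _ ⟨X, rfl, hX⟩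
  exact ⟨X, rfl, fun N c => ⟨_, rfl,
    inferInstanceAs (ProperSpace (X.carrier × (Fin N → unitInterval)))⟩⟩

theorem not_polishSpace_compact : ¬ PolishSpace compact := by
  refine not_polishSpace_of_perturb (fun _ h => h.1) ⟨_, mk_point_mem_compact⟩ ?_
  rintro _ ⟨-, X, rfl, hX⟩
  refine ⟨X, rfl, fun N c => ?_⟩
  have : CompactSpace (X.perturb N c).carrier :=
    inferInstanceAs (CompactSpace (X.carrier × (Fin N → unitInterval)))
  exact ⟨⟨_, rfl, inferInstance⟩, _, rfl, this⟩

end MMSpace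

end Perturbation
theorem mainTheorem6 :
    (IsLusinSpace MMSpace.heineBorel ∧ ¬ PolishSpace MMSpace.heineBorel) ∧
      (IsLusinSpace MMSpace.compact ∧ ¬ PolishSpace MMSpace.compact) :=
  ⟨⟨MMSpace.isLusinSpace_heineBorel, MMSpace.not_polishSpace_heineBorel⟩,
    MMSpace.isLusinSpace_compact, MMSpace.not_polishSpace_compact⟩
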